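/- Let $\mathcal A$ be the space of finitely supported functions $f:\mathbb Z\to\mathbb C$, let $\widetilde{\mathcal A}=\mathbb C\oplus\mathcal A$ (constants plus finitely supported functions), and let $\Lambda f(n)=f(n+1)$. Difference operators $\sum_i f_i\Lambda^i$ are multiplied by $f(n)\Lambda^i\cdot g(n)\Lambda^j=f(n)g(n+i)\Lambda^{i+j}$ (only operators whose orders are both bounded above, or both bounded below, are multiplied). For $A=\sum_i f_i\Lambda^i$ put $A_{\ge k}=\sum_{i\ge k}f_i\Lambda^i$, $A_{<k}=\sum_{i<k}f_i\Lambda^i$ (similarly $A_{\le k}$, $A_{>k}$), $\operatorname{Res}A=f_0$ and $\langle A\rangle=\sum_{n\in\mathbb Z}f_0(n)$. The phase space consists of the pairs $$L=\Lambda+\sum_{i\le 0}u_i\Lambda^i,\qquad \hat L=\sum_{i\ge-1}\hat u_i\Lambda^i,$$ with $u_i\in\mathcal A$ for $i\le 0$, $\hat u_i\in\mathcal A$ for $i\ge0$, and $\hat u_{-1}\in\widetilde{\mathcal A}$ vanishing nowhere on $\mathbb Z$ (so that $\hat L$ is invertible). A variation $(\delta L,\delta\hat L)$ is a pair of operators with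 coefficients in $\mathcal A$, $\delta L=(\delta L)_{\le 0}$ and $\delta\hat L=(\delta\hat L)_{\ge -1}$. The Toda lattice hierarchy is the family of vector fields, $k\ge1$, $$\frac{\partial L}{\partial t_k}=[(L^k)_{\ge0},L],\quad \frac{\partial\hat L}{\partial t_k}=[(L^k)_{\ge0},\hat L],\quad \frac{\partial L}{\partial\hat t_k}=[-(\hat L^k)_{<0},L],\quad \frac{\partial\hat L}{\partial\hat t_k}=[-(\hat L^k)_{<0},\hat L].$$ For a function $F$ on the phase space, $\partial F/\partial t_k$ and $\partial F/\partial\hat t_k$ denote its derivatives along these vector fields. Fix positive integers $N,M$ and put $\mathbf A=(A,\hat A)=(L^N,\hat L^M)$. A covector is a pair $(X,\hat X)$ of operators of finite order with coefficients in $\widetilde{\mathcal A}$ such that $X=X_{>-N}$ and $\hat X=\hat X_{\le M}$. A gradient $\delta F/\delta\mathbf A$ of $F$ at $(L,\hat L)$ is a covector $(X,\hat X)$ such that for every variation the directional (complex) derivative of $F$ is $\delta F=\langle X\,\delta A\rangle+\langle\hat X\,\delta\hat A\rangle$, where $\delta A=\sum_{a<N}L^a\,\delta L\,L^{N-1-a}$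 and $\delta\hat A=\sum_{a<M}\hat L^a\,\delta\hat L\,\hat L^{M-1-a}$. Writing $Q=[X,A]+[\hat X,\hat A]$ and $S=AX+XA+\hat A\hat X+\hat X\hat A$, let $$\mathcal P_1(X,\hat X)=\big([-X_{<0}-\hat X_{<0},A]+Q_{\le0},\ [X_{\ge0}+\hat X_{\ge0},\hat A]-Q_{>0}\big),$$ $$\mathcal P_2(X,\hat X)=\tfrac12\big([-S_{<0},A]+AQ_{\le0}+Q_{\le0}A,\ [S_{\ge0},\hat A]-\hat AQ_{>0}-Q_{>0}\hat A\big)-\big([f,A],[f,\hat A]\big),$$ $$f=\tfrac12(1+\Lambda^N)(1-\Lambda^N)^{-1}(\operatorname{Res}Q),\qquad(1-\Lambda^N)^{-1}=1+\Lambda^N+\Lambda^{2N}+\cdots,$$ and define the reduced brackets on the set of pairs $(L^N,\hat L^M)$ by $$\{F,G\}_\nu^{N,M}=\Big\langle\frac{\delta F}{\delta\mathbf A},\ \mathcal P_\nu\Big(\frac{\delta G}{\delta\mathbf A}\Big)\Big\rangle,\qquad \nu=1,2,\qquad \langle(X,\hat X),(Y,\hat Y)\rangle=\langle XY\rangle+\langle\hat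 X\hat Y\rangle .$$ **Theorem.** For all positive integers $N$ and $M$ the Toda lattice hierarchy has the following bi-Hamiltonian representation. At every point of the phase space a function has at most one gradient; for every $k\ge1$ the functionals $$H_k=\frac Nk\langle L^k\rangle,\qquad \hat H_k=\frac Mk\langle\hat L^k\rangle$$ have a gradient, the values of the vector fields $\partial/\partial t_k$, $\partial/\partial\hat t_k$ are variations, and for every functional $F$ that has a gradient at the point, $$\frac{\partial F}{\partial t_k}=\{F,H_{k+N}\}_1^{N,M}=\{F,H_k\}_2^{N,M},\qquad \frac{\partial F}{\partial\hat t_k}=\{F,\hat H_{k+M}\}_1^{N,M}=\{F,\hat H_k\}_2^{N,M}.$$ -/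

import Mathlib

noncomputable section

namespace Toda

/-- Difference operators `∑ i, f_i Λ^i` whose coefficients are functions on the lattice `ℤ`:
`A i n` is the value at the site `n` of the coefficient of `Λ^i`. -/
abbrev Op : Type := ℤ → ℤ → ℂ

/-- The product determined by `f(n) Λ^i ⋆ g(n) Λ^j = f(n) g(n+i) Λ^(i+j)`. It is only used for two
operators with orders both bounded above, or both bounded below; then every sum is finite. -/
def opMul (A B : Op) : Op := fun i n => ∑ᶠ j : ℤ, A j n * B (i - j) (n + j)

infixl:70 " ⋆ " => opMul

/-- The commutator. -/
def comm (A B : Op) : Op := A ⋆ B - B ⋆ A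

/-- The operator of multiplication by a function. -/
def mulOp (f : ℤ → ℂ) : Op := fun i => if i = 0 then f else 0

/-- Powers of an operator. -/
def opPow (A : Op) : ℕ → Op
  | 0 => mulOp 1
  | k + 1 => opPow A k ⋆ A

/-- The part `A_{≥ k}`. -/
def partGE (k : ℤ) (A : Op) : Op := fun i => if k ≤ i then A i else 0

/-- The part `A_{< k}`. -/
def partLT (k : ℤ) (A : Op) : Op := fun i => if i < k then A i else 0

/-- `Res A`, the coefficient of `Λ^0`. -/
def res (A : Op) : ℤ → ℂ := A 0

/-- `⟨A⟩`, the sum over the lattice of `Res A`. -/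
def tr (A : Op) : ℂ := ∑ᶠ n : ℤ, res A n

/-- The inner product `⟨X Y⟩ + ⟨X̂ Ŷ⟩` of pairs. -/
def pairing (X Y : Op × Op) : ℂ := tr (X.1 ⋆ Y.1) + tr (X.2 ⋆ Y.2)

/-- Functions on the lattice with finite support. -/
def FinSupp (f : ℤ → ℂ) : Prop := (Function.support f).Finite

/-- Functions of the form constant plus finitely supported function. -/
def AlmostConst (f : ℤ → ℂ) : Prop := ∃ c : ℂ, FinSupp (fun n => f n - c)

/-- The pairs `(L, L̂)` with `L = Λ + ∑_{i ≤ 0} u_i Λ^i` and `L̂ = ∑_{i ≥ -1} û_i Λ^i`. The functions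
`u_i` and `û_i` with `i ≥ 0` have finite support; `û_{-1}` is a constant plus a finitely supported
function and vanishes nowhere, that is, `L̂` is invertible. -/
structure IsLaxPair (p : Op × Op) : Prop where
  lead : p.1 1 = 1
  top : ∀ i : ℤ, 1 < i → p.1 i = 0
  fin : ∀ i : ℤ, i ≤ 0 → FinSupp (p.1 i)
  hat_bot : ∀ i : ℤ, i < -1 → p.2 i = 0
  hat_fin : ∀ i : ℤ, 0 ≤ i → FinSupp (p.2 i)
  hat_lead : AlmostConst (p.2 (-1))
  hat_ne : ∀ n : ℤ, p.2 (-1) n ≠ 0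

/-- The variations `(δL, δL̂)`: finitely supported changes of the `u_i` and the `û_i`. -/
structure IsVariation (V : Op × Op) : Prop where
  top : ∀ i : ℤ, 0 < i → V.1 i = 0
  fin : ∀ i : ℤ, FinSupp (V.1 i)
  hat_bot : ∀ i : ℤ, i < -1 → V.2 i = 0
  hat_fin : ∀ i : ℤ, FinSupp (V.2 i)

/-- The vector field `∂/∂t_k` of the Toda lattice hierarchy,
`(∂L/∂t_k, ∂L̂/∂t_k) = ([(L^k)_{≥0}, L], [(L^k)_{≥0}, L̂])`. -/
def flow (k : ℕ) (p : Op × Op) : Op × Op :=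
  (comm (partGE 0 (opPow p.1 k)) p.1, comm (partGE 0 (opPow p.1 k)) p.2)

/-- The vector field `∂/∂t̂_k` of the Toda lattice hierarchy,
`(∂L/∂t̂_k, ∂L̂/∂t̂_k) = ([-(L̂^k)_{<0}, L], [-(L̂^k)_{<0}, L̂])`. -/
def flowHat (k : ℕ) (p : Op × Op) : Op × Op :=
  (comm (-partLT 0 (opPow p.2 k)) p.1, comm (-partLT 0 (opPow p.2 k)) p.2)

/-- `𝐀 = (A, Â) = (L^N, L̂^M)`. -/
def powPair (N M : ℕ) (p : Op × Op) : Op × Op := (opPow p.1 N, opPow p.2 M)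

/-- First variation of `B^N` under a variation `δB` of `B`: `∑_{a < N} B^a δB B^(N-1-a)`. -/
def powVar (N : ℕ) (B dB : Op) : Op :=
  ∑ a ∈ Finset.range N, opPow B a ⋆ dB ⋆ opPow B (N - 1 - a)

/-- First variation of `𝐀` under a variation `(δL, δL̂)`. -/
def powPairVar (N M : ℕ) (p V : Op × Op) : Op × Op := (powVar N p.1 V.1, powVar M p.2 V.2)

/-- The cotangent fibre: pairs `(X, X̂)` of operators of finite order with `X = X_{> -N}` and
`X̂ = X̂_{≤ M}`. Constants are allowed in the coefficients because the gradients of the Hamiltonians,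
the truncations of `L^(k-N)` and `L̂^(k-M)`, have a leading coefficient that is not finitely
supported. -/
structure IsCovector (N M : ℕ) (X : Op × Op) : Prop where
  coeff : ∀ i : ℤ, AlmostConst (X.1 i)
  bot : ∀ i : ℤ, i ≤ -(N : ℤ) → X.1 i = 0
  top : ∃ K : ℤ, ∀ i : ℤ, K < i → X.1 i = 0
  hat_coeff : ∀ i : ℤ, AlmostConst (X.2 i)
  hat_top : ∀ i : ℤ, (M : ℤ) < i → X.2 i = 0
  hat_bot : ∃ K : ℤ, ∀ i : ℤ, i < K → X.2 i = 0

/-- `X` is a gradient `δF/δ𝐀` at the point with coordinates `(L, L̂)`: the variation of `F` is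
`δF = ⟨X, δ𝐀⟩` for every variation of `(L, L̂)`. Only values of `F` at pairs as in `IsLaxPair`
matter, because these pairs contain `p + s • V` for all small `s`. -/
def HasGradient (N M : ℕ) (F : Op × Op → ℂ) (p X : Op × Op) : Prop :=
  IsCovector N M X ∧ ∀ V : Op × Op, IsVariation V →
    HasDerivAt (fun s : ℂ => F (p + s • V)) (pairing X (powPairVar N M p V)) 0

/-- `F` has a gradient at `p`. -/
def HasSomeGradient (N M : ℕ) (F : Op × Op → ℂ) (p : Op × Op) : Prop :=
  ∃ X : Op × Op, HasGradient N M F p X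

open Classical in
/-- The gradient `δF/δ𝐀` at `p` (zero if there is none). -/
def grad (N M : ℕ) (F : Op × Op → ℂ) (p : Op × Op) : Op × Op :=
  if h : HasSomeGradient N M F p then h.choose else 0

/-- `[X, A] + [X̂, Â]`. -/
def commSum (A X : Op × Op) : Op := comm X.1 A.1 + comm X.2 A.2

/-- The linear tensor
`([-X_{<0} - X̂_{<0}, A] + [X, A]_{≤0} + [X̂, Â]_{≤0},
  [X_{≥0} + X̂_{≥0}, Â] - [X, A]_{>0} - [X̂, Â]_{>0})`. -/
def tensor1 (A X : Op × Op) : Op × Op :=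
  (comm (-partLT 0 X.1 - partLT 0 X.2) A.1 + partLT 1 (commSum A X),
   comm (partGE 0 X.1 + partGE 0 X.2) A.2 - partGE 1 (commSum A X))

/-- `A X + X A + Â X̂ + X̂ Â`. -/
def anticommSum (A X : Op × Op) : Op :=
  (A.1 ⋆ X.1 + X.1 ⋆ A.1) + (A.2 ⋆ X.2 + X.2 ⋆ A.2)

/-- The quadratic tensor before reduction, one half of
`([-(A X + X A + Â X̂ + X̂ Â)_{<0}, A] + A Q_{≤0} + Q_{≤0} A,
  [(A X + X A + Â X̂ + X̂ Â)_{≥0}, Â] - Â Q_{>0} - Q_{>0} Â)`, where `Q = [X, A] + [X̂, Â]`. -/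
def tensor2 (A X : Op × Op) : Op × Op :=
  (2⁻¹ : ℂ) •
    (comm (-partLT 0 (anticommSum A X)) A.1
        + A.1 ⋆ partLT 1 (commSum A X) + partLT 1 (commSum A X) ⋆ A.1,
     comm (partGE 0 (anticommSum A X)) A.2
        - A.2 ⋆ partGE 1 (commSum A X) - partGE 1 (commSum A X) ⋆ A.2)

/-- `(1 - Λ^N)⁻¹ = 1 + Λ^N + Λ^(2N) + ⋯` on functions. -/
def geomShift (N : ℕ) (r : ℤ → ℂ) : ℤ → ℂ := fun n => ∑ᶠ j : ℕ, r (n + j * N)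

/-- `f = (1/2) (1 + Λ^N) (1 - Λ^N)⁻¹ (Res ([X, A] + [X̂, Â]))`. -/
def corr (N : ℕ) (A X : Op × Op) : ℤ → ℂ := fun n =>
  2⁻¹ * (geomShift N (res (commSum A X)) n + geomShift N (res (commSum A X)) (n + N))

/-- The reduced quadratic tensor, `tensor2 - ([f, A], [f, Â])`. -/
def tensor2Red (N : ℕ) (A X : Op × Op) : Op × Op :=
  tensor2 A X - (comm (mulOp (corr N A X)) A.1, comm (mulOp (corr N A X)) A.2)

/-- The first reduced bracket; the linear tensor restricts without correction. -/
def bracket1 (N M : ℕ) (F G : Op × Op → ℂ) (p : Op × Op) : ℂ :=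
  pairing (grad N M F p) (tensor1 (powPair N M p) (grad N M G p))

/-- The second reduced bracket. -/
def bracket2 (N M : ℕ) (F G : Op × Op → ℂ) (p : Op × Op) : ℂ :=
  pairing (grad N M F p) (tensor2Red N (powPair N M p) (grad N M G p))

/-- `H_k = (N/k) ⟨L^k⟩`. -/
def ham (N k : ℕ) (p : Op × Op) : ℂ := (N : ℂ) / (k : ℂ) * tr (opPow p.1 k)

/-- `Ĥ_k = (M/k) ⟨L̂^k⟩`. -/
def hamHat (M k : ℕ) (p : Op × Op) : ℂ := (M : ℂ) / (k : ℂ) * tr (opPow p.2 k)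

end Toda

end

noncomputable section

namespace Toda

open Filter

/-! Both flows have the form ([P, L], [P, L̂]), with P = (L^k)_{≥0} or P = -(L̂^k)_{<0}. Commutation
with P is a derivation, so 𝐀 varies by ([P, A], [P, Â]), and the definition of a gradient turns the
derivative of F along the flow into ⟨δF/δ𝐀, ([P, A], [P, Â])⟩. It is therefore enough that each
tensor, evaluated at the gradient of its Hamiltonian, returns exactly ([P, A], [P, Â]).

Put B = L^(k-N). Cyclicity of the trace gives ⟨B δA⟩ = N⟨L^(k-1) δL⟩ = δH_k, and since δA has order
at most N-1 only X = B_{>-N} contributes (`hasDerivAt_hamiltonian`). Let R = B - X. As B commutes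
with A, Q = [X, A] = -[R, A] has order at most 0, so the projections of Q become trivial and the
tensors collapse to commutators with X_{≥0} and with (AX + XA)_{≥0}/2. For the first bracket the
index k+N gives B = L^k. For the second, AX + XA = 2L^k - (AR + RA), and AR + RA has in nonnegative
orders only the residue r(n) + r(n+N), where r is the coefficient of Λ^(-N) in B. Since Res Q =
r(n+N) - r(n), the function f is -(r(n) + r(n+N))/2, and the reduction removes exactly this surplus
(`tensor2Red_ham`). On the hatted side the discarded part starts one order further out and f = 0.

Uniqueness (`eq_zero_of_tr_mul_dpow`): if Z is orthogonal to all δA, testing with one-site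
variations kills the leading coefficient of ∑ L^a Z L^(N-1-a). The commutator of this sum with L is
[L^N, Z] up to sign, whence a recursion propagates a nonzero leading value of Z along an infinite
progression, although that coefficient has finite support.

The sign ε treats L (ε = 1) and L̂ (ε = -1) simultaneously. -/

/-- The operator `A` has order at most `m` with respect to the degree `ε * i` of `Λ^i`. -/
def OrdLE (ε : ℤˣ) (m : ℤ) (A : Op) : Prop := ∀ i : ℤ, m < ε * i → A i = 0

/-! ### Orders and the laws of the product -/

theorem OrdLE.mono {ε : ℤˣ} {m m' : ℤ} {A : Op} (h : OrdLE ε m A) (hm : m ≤ m') :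
    OrdLE ε m' A := fun i hi => h i (by omega)

theorem OrdLE.zero (ε : ℤˣ) (m : ℤ) : OrdLE ε m 0 := fun _ _ => rfl

theorem OrdLE.add {ε : ℤˣ} {m : ℤ} {A B : Op} (hA : OrdLE ε m A) (hB : OrdLE ε m B) :
    OrdLE ε m (A + B) := fun i hi => by simp [hA i hi, hB i hi]

theorem OrdLE.neg {ε : ℤˣ} {m : ℤ} {A : Op} (hA : OrdLE ε m A) :
    OrdLE ε m (-A) := fun i hi => by simp [hA i hi]

theorem OrdLE.sub {ε : ℤˣ} {m : ℤ} {A B : Op} (hA : OrdLE ε m A) (hB : OrdLE ε m B) :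
    OrdLE ε m (A - B) := fun i hi => by simp [hA i hi, hB i hi]

theorem OrdLE.smul {ε : ℤˣ} {m : ℤ} {A : Op} (c : ℂ) (hA : OrdLE ε m A) :
    OrdLE ε m (c • A) := fun i hi => by simp [hA i hi]

theorem OrdLE.sum {ε : ℤˣ} {m : ℤ} {ι : Type*} {s : Finset ι} {A : ι → Op}
    (hA : ∀ a ∈ s, OrdLE ε m (A a)) : OrdLE ε m (∑ a ∈ s, A a) := fun i hi => by
  rw [Finset.sum_apply]
  exact Finset.sum_eq_zero fun a ha => hA a ha i hi

theorem OrdLE.mul {ε : ℤˣ} {a b : ℤ} {A B : Op} (hA : OrdLE ε a A) (hB : OrdLE ε b B) :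
    OrdLE ε (a + b) (A ⋆ B) := fun i hi => by
  funext n
  refine finsum_eq_zero_of_forall_eq_zero fun j => ?_
  by_cases hj : a < ε * j
  · simp [hA j hj]
  · have : b < ε * (i - j) := by rw [mul_sub]; omega
    simp [hB _ this]

theorem OrdLE.mulOp (ε : ℤˣ) (f : ℤ → ℂ) : OrdLE ε 0 (mulOp f) := fun i hi => by
  have : i ≠ 0 := by rintro rfl; simp at hi
  simp [Toda.mulOp, this]

theorem units_mul_mul (ε : ℤˣ) (j : ℤ) : (ε : ℤ) * (ε * j) = j := by
  rw [← mul_assoc, Int.units_coe_mul_self, one_mul]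

theorem units_mul_eq_iff (ε : ℤˣ) (i j : ℤ) : (ε : ℤ) * i = j ↔ i = ε * j := by
  constructor <;> rintro rfl <;> simp [units_mul_mul]

/-- Only finitely many orders contribute to a coefficient of a product. -/
theorem exists_window (ε : ℤˣ) (a b i : ℤ) :
    ∃ s : Finset ℤ, ∀ j : ℤ, ε * j ≤ a → ε * (i - j) ≤ b → j ∈ s := by
  refine ⟨(Finset.Icc (ε * i - b) a).image (fun j => ε * j), fun j h1 h2 => ?_⟩
  rw [mul_sub] at h2
  exact Finset.mem_image.2 ⟨ε * j, Finset.mem_Icc.2 ⟨by omega, h1⟩, units_mul_mul ε j⟩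

theorem opMul_eq_sum {ε : ℤˣ} {a b : ℤ} {A B : Op} (hA : OrdLE ε a A) (hB : OrdLE ε b B)
    {i : ℤ} {s : Finset ℤ} (hs : ∀ j : ℤ, ε * j ≤ a → ε * (i - j) ≤ b → j ∈ s) (n : ℤ) :
    (A ⋆ B) i n = ∑ j ∈ s, A j n * B (i - j) (n + j) := by
  refine finsum_eq_sum_of_support_subset _ fun j hj => ?_
  by_contra hjs
  apply hj
  by_cases h1 : ε * j ≤ a
  · have h2 : ¬ ε * (i - j) ≤ b := fun h2 => hjs (hs j h1 h2)
    simp [hB _ (not_le.1 h2)]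
  · simp [hA _ (not_le.1 h1)]

/-- Only the two leading terms can reach the total order a + b. -/
theorem opMul_top {ε : ℤˣ} {a b : ℤ} {A B : Op} (hA : OrdLE ε a A) (hB : OrdLE ε b B) (n : ℤ) :
    (A ⋆ B) (ε * (a + b)) n = A (ε * a) n * B (ε * b) (n + ε * a) := by
  rw [opMul_eq_sum hA hB (s := {ε * a})]
  · simp [mul_add]
  · intro j h1 h2
    rw [mul_sub, units_mul_mul] at h2
    rw [Finset.mem_singleton, ← units_mul_eq_iff]
    omega

/-- Order bounds in a common direction confine both iterated products to finite windows; each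
becomes the same double sum and the summations may be exchanged. -/
theorem opMul_assoc {ε : ℤˣ} {a b c : ℤ} {A B C : Op} (hA : OrdLE ε a A) (hB : OrdLE ε b B)
    (hC : OrdLE ε c C) : A ⋆ B ⋆ C = A ⋆ (B ⋆ C) := by
  funext i n
  obtain ⟨s, hs⟩ := exists_window ε a (b + c) i
  obtain ⟨t, ht⟩ := exists_window ε (a + b) c i
  rw [opMul_eq_sum (hA.mul hB) hC ht, opMul_eq_sum hA (hB.mul hC) hs]
  have h1 : ∀ j ∈ t, (A ⋆ B) j n * C (i - j) (n + j)
      = ∑ l ∈ s, A l n * B (j - l) (n + l) * C (i - j) (n + j) := by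
    intro j _
    by_cases hc : ε * (i - j) ≤ c
    · rw [opMul_eq_sum hA hB (s := s), Finset.sum_mul]
      intro l h1 h2
      apply hs l h1
      rw [mul_sub] at *
      omega
    · simp [hC _ (not_le.1 hc)]
  have h2 : ∀ l ∈ s, A l n * (B ⋆ C) (i - l) (n + l)
      = ∑ j ∈ t, A l n * B (j - l) (n + l) * C (i - j) (n + j) := by
    intro l _
    by_cases hc : ε * l ≤ a
    · rw [opMul_eq_sum hB hC (s := t.image (fun j => j - l)), Finset.sum_image, Finset.mul_sum]
      · refine Finset.sum_congr rfl fun j _ => ?_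
        rw [show i - l - (j - l) = i - j by ring, show n + l + (j - l) = n + j by ring, mul_assoc]
      · intro x _ y _ h
        simpa using h
      · intro j h1 h2
        refine Finset.mem_image.2 ⟨j + l, ht _ ?_ ?_, by ring⟩
        · rw [mul_add]; omega
        · rw [show i - (j + l) = i - l - j by ring]; exact h2
    · simp [hA _ (not_le.1 hc)]
  rw [Finset.sum_congr rfl h1, Finset.sum_congr rfl h2, Finset.sum_comm]

theorem add_opMul {ε : ℤˣ} {a b c : ℤ} {A B C : Op} (hA : OrdLE ε a A) (hB : OrdLE ε b B)
    (hC : OrdLE ε c C) : (A + B) ⋆ C = A ⋆ C + B ⋆ C := by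
  funext i n
  have hA' := hA.mono (le_max_left a b)
  have hB' := hB.mono (le_max_right a b)
  obtain ⟨s, hs⟩ := exists_window ε (max a b) c i
  simp only [Pi.add_apply]
  rw [opMul_eq_sum (hA'.add hB') hC hs, opMul_eq_sum hA' hC hs, opMul_eq_sum hB' hC hs,
    ← Finset.sum_add_distrib]
  exact Finset.sum_congr rfl fun j _ => by simp [add_mul]

theorem opMul_add {ε : ℤˣ} {a b c : ℤ} {A B C : Op} (hA : OrdLE ε a A) (hB : OrdLE ε b B)
    (hC : OrdLE ε c C) : C ⋆ (A + B) = C ⋆ A + C ⋆ B := by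
  funext i n
  have hA' := hA.mono (le_max_left a b)
  have hB' := hB.mono (le_max_right a b)
  obtain ⟨s, hs⟩ := exists_window ε c (max a b) i
  simp only [Pi.add_apply]
  rw [opMul_eq_sum hC (hA'.add hB') hs, opMul_eq_sum hC hA' hs, opMul_eq_sum hC hB' hs,
    ← Finset.sum_add_distrib]
  exact Finset.sum_congr rfl fun j _ => by simp [mul_add]

theorem smul_opMul (c : ℂ) (A B : Op) : (c • A) ⋆ B = c • (A ⋆ B) := by
  funext i n
  simp only [opMul, Pi.smul_apply, smul_eq_mul, mul_assoc]
  simp only [← smul_eq_mul (a := c), ← smul_finsum]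

theorem opMul_smul (c : ℂ) (A B : Op) : A ⋆ (c • B) = c • (A ⋆ B) := by
  funext i n
  simp only [opMul, Pi.smul_apply, smul_eq_mul, mul_left_comm _ c]
  simp only [← smul_eq_mul (a := c), ← smul_finsum]

theorem zero_opMul (A : Op) : 0 ⋆ A = 0 := by
  funext i n; simp [opMul]

theorem opMul_zero (A : Op) : A ⋆ 0 = 0 := by
  funext i n; simp [opMul]

/-- A product whose left factor is a function. -/
theorem mulOp_opMul (f : ℤ → ℂ) (A : Op) : mulOp f ⋆ A = fun i n => f n * A i n := by
  funext i n
  rw [opMul, finsum_eq_single _ 0]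
  · simp [mulOp]
  · intro j hj; simp [mulOp, hj]

theorem opMul_mulOp (f : ℤ → ℂ) (A : Op) : A ⋆ mulOp f = fun i n => A i n * f (n + i) := by
  funext i n
  rw [opMul, finsum_eq_single _ i]
  · simp [mulOp]
  · intro j hj
    have : i - j ≠ 0 := by omega
    simp [mulOp, this]

/-! ### The rings of operators bounded on one side -/

/-- The operators whose orders are bounded above (`ε = 1`) or below (`ε = -1`). -/
def bddOps (ε : ℤˣ) : Submodule ℂ Op where
  carrier := {A | ∃ m, OrdLE ε m A}
  add_mem' := by
    rintro A B ⟨a, hA⟩ ⟨b, hB⟩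
    exact ⟨max a b, (hA.mono (le_max_left a b)).add (hB.mono (le_max_right a b))⟩
  zero_mem' := ⟨0, OrdLE.zero ε 0⟩
  smul_mem' := by
    rintro c A ⟨a, hA⟩
    exact ⟨a, hA.smul c⟩

/-- The algebra of difference operators with orders bounded above (`ε = 1`) or below
(`ε = -1`). -/
def DOp (ε : ℤˣ) : Type := bddOps ε

namespace DOp

variable {ε : ℤˣ}

instance : AddCommGroup (DOp ε) := inferInstanceAs (AddCommGroup (bddOps ε))

instance : Module ℂ (DOp ε) := inferInstanceAs (Module ℂ (bddOps ε))

/-- The underlying difference operator. -/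
def op (A : DOp ε) : Op := A.1

/-- An operator of bounded order as an element of the algebra. -/
def mk (A : Op) {m : ℤ} (h : OrdLE ε m A) : DOp ε := ⟨A, m, h⟩

@[simp] theorem op_mk (A : Op) {m : ℤ} (h : OrdLE ε m A) : (mk A h).op = A := rfl

theorem exists_ordLE (A : DOp ε) : ∃ m, OrdLE ε m A.op := A.2

@[ext] theorem ext {A B : DOp ε} (h : A.op = B.op) : A = B := Subtype.ext h

instance : Mul (DOp ε) where
  mul A B := ⟨A.op ⋆ B.op, by
    obtain ⟨a, ha⟩ := A.2
    obtain ⟨b, hb⟩ := B.2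
    exact ⟨_, ha.mul hb⟩⟩

instance : One (DOp ε) := ⟨mk (mulOp 1) (OrdLE.mulOp ε 1)⟩

@[simp] theorem op_mul (A B : DOp ε) : (A * B).op = A.op ⋆ B.op := rfl
@[simp] theorem op_one : (1 : DOp ε).op = mulOp 1 := rfl
@[simp] theorem op_add (A B : DOp ε) : (A + B).op = A.op + B.op := rfl
@[simp] theorem op_sub (A B : DOp ε) : (A - B).op = A.op - B.op := rfl
@[simp] theorem op_zero : (0 : DOp ε).op = 0 := rfl
@[simp] theorem op_smul (c : ℂ) (A : DOp ε) : (c • A).op = c • A.op := rfl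

instance : Ring (DOp ε) where
  __ := (inferInstance : AddCommGroup (DOp ε))
  mul := Mul.mul
  one := One.one
  mul_assoc A B C := by
    obtain ⟨a, ha⟩ := A.2
    obtain ⟨b, hb⟩ := B.2
    obtain ⟨c, hc⟩ := C.2
    exact DOp.ext (opMul_assoc ha hb hc)
  one_mul A := DOp.ext (by simp [mulOp_opMul])
  mul_one A := DOp.ext (by simp [opMul_mulOp])
  zero_mul A := DOp.ext (zero_opMul _)
  mul_zero A := DOp.ext (opMul_zero _)
  left_distrib A B C := by
    obtain ⟨a, ha⟩ := A.2
    obtain ⟨b, hb⟩ := B.2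
    obtain ⟨c, hc⟩ := C.2
    exact DOp.ext (opMul_add hb hc ha)
  right_distrib A B C := by
    obtain ⟨a, ha⟩ := A.2
    obtain ⟨b, hb⟩ := B.2
    obtain ⟨c, hc⟩ := C.2
    exact DOp.ext (add_opMul ha hb hc)

instance : Algebra ℂ (DOp ε) :=
  Algebra.ofModule (fun c A B => DOp.ext (smul_opMul c A.op B.op))
    (fun c A B => DOp.ext (opMul_smul c A.op B.op))

@[simp] theorem op_pow (A : DOp ε) (k : ℕ) : (A ^ k).op = opPow A.op k := by
  induction k with
  | zero => simp [opPow]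
  | succ k ih => rw [pow_succ, op_mul, ih, opPow]

@[simp] theorem op_sum {ι : Type*} (s : Finset ι) (A : ι → DOp ε) :
    (∑ a ∈ s, A a).op = ∑ a ∈ s, (A a).op :=
  map_sum (⟨⟨op, rfl⟩, fun _ _ => rfl⟩ : DOp ε →+ Op) A s

theorem op_powVar (N : ℕ) (A V : DOp ε) :
    (∑ a ∈ Finset.range N, A ^ a * V * A ^ (N - 1 - a)).op = powVar N A.op V.op := by
  simp [powVar]

end DOp

theorem OrdLE.pow {ε : ℤˣ} {a : ℤ} {A : Op} (hA : OrdLE ε a A) (k : ℕ) :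
    OrdLE ε (k * a) (opPow A k) := by
  induction k with
  | zero => simpa [opPow] using OrdLE.mulOp ε 1
  | succ k ih => exact (ih.mul hA).mono (by push_cast; linarith)

/-! ### Symbols: coefficients away from a finite set of sites -/

theorem finSupp_iff {f : ℤ → ℂ} : FinSupp f ↔ ∀ᶠ n in cofinite, f n = 0 := by
  rw [eventually_cofinite]; rfl

theorem almostConst_iff {f : ℤ → ℂ} : AlmostConst f ↔ ∃ c, ∀ᶠ n in cofinite, f n = c := by
  simp only [AlmostConst, finSupp_iff, sub_eq_zero]

theorem eventually_cofinite_shift {P : ℤ → Prop} (h : ∀ᶠ n in cofinite, P n) (j : ℤ) :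
    ∀ᶠ n in cofinite, P (n + j) :=
  (add_left_injective j).tendsto_cofinite.eventually h

/-- The coefficients of `A` are constants `a i` up to finitely supported functions. -/
def Symb (a : ℤ → ℂ) (A : Op) : Prop := ∀ i : ℤ, ∀ᶠ n in cofinite, A i n = a i

/-- The convolution of constant symbols. -/
def conv (a b : ℤ → ℂ) : ℤ → ℂ := fun i => ∑ᶠ j : ℤ, a j * b (i - j)

/-- Constant-coefficient difference operators commute. This is why commutators of operators with
almost constant coefficients have finitely supported coefficients. -/
theorem conv_comm (a b : ℤ → ℂ) : conv a b = conv b a := by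
  funext i
  rw [conv, conv, ← finsum_comp_equiv (Equiv.subLeft i)]
  exact finsum_congr fun j => by simp [mul_comm]

theorem conv_zero (a : ℤ → ℂ) : conv a 0 = 0 := by
  funext i; simp [conv]

theorem conv_single (i j : ℤ) (c d : ℂ) :
    conv (Pi.single i c) (Pi.single j d) = Pi.single (i + j) (c * d) := by
  funext l
  rw [conv, finsum_eq_single _ i]
  · by_cases h : l = i + j
    · subst h; simp
    · have : l - i ≠ j := by omega
      simp [h, this]
  · intro m hm; simp [hm]

theorem Symb.zero : Symb 0 0 := fun _ => Eventually.of_forall fun _ => rfl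

theorem Symb.one : Symb (Pi.single 0 1) (mulOp 1) := fun i => Eventually.of_forall fun n => by
  by_cases h : i = 0
  · subst h; simp [mulOp]
  · simp [mulOp, h]

theorem Symb.add {a b : ℤ → ℂ} {A B : Op} (hA : Symb a A) (hB : Symb b B) :
    Symb (a + b) (A + B) := fun i => by
  filter_upwards [hA i, hB i] with n h1 h2
  simp [h1, h2]

theorem Symb.neg {a : ℤ → ℂ} {A : Op} (hA : Symb a A) : Symb (-a) (-A) := fun i => by
  filter_upwards [hA i] with n h1
  simp [h1]

theorem Symb.sub {a b : ℤ → ℂ} {A B : Op} (hA : Symb a A) (hB : Symb b B) :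
    Symb (a - b) (A - B) := fun i => by
  filter_upwards [hA i, hB i] with n h1 h2
  simp [h1, h2]

theorem Symb.smul {a : ℤ → ℂ} {A : Op} (c : ℂ) (hA : Symb a A) : Symb (c • a) (c • A) :=
  fun i => by
  filter_upwards [hA i] with n h1
  simp [h1]

theorem Symb.sum {ι : Type*} {s : Finset ι} {A : ι → Op} {a : ι → ℤ → ℂ}
    (h : ∀ i ∈ s, Symb (a i) (A i)) : Symb (∑ i ∈ s, a i) (∑ i ∈ s, A i) := fun j => by
  have : ∀ᶠ n in cofinite, ∀ i ∈ s, A i j n = a i j :=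
    (Finset.eventually_all s).2 fun i hi => h i hi j
  filter_upwards [this] with n hn
  simp only [Finset.sum_apply]
  exact Finset.sum_congr rfl hn

theorem Symb.eq_zero {ε : ℤˣ} {a : ℤ → ℂ} {m : ℤ} {A : Op} (hA : Symb a A) (h : OrdLE ε m A)
    {i : ℤ} (hi : m < ε * i) : a i = 0 := by
  obtain ⟨n, hn⟩ := (hA i).exists
  rw [← hn, h i hi]; rfl

theorem Symb.mul {ε : ℤˣ} {a b : ℤ → ℂ} {k m : ℤ} {A B : Op} (hA : Symb a A) (hB : Symb b B)
    (hA' : OrdLE ε k A) (hB' : OrdLE ε m B) : Symb (conv a b) (A ⋆ B) := fun i => by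
  obtain ⟨s, hs⟩ := exists_window ε k m i
  have h1 : ∀ᶠ n in cofinite, ∀ j ∈ s, A j n = a j :=
    (Finset.eventually_all s).2 fun j _ => hA j
  have h2 : ∀ᶠ n in cofinite, ∀ j ∈ s, B (i - j) (n + j) = b (i - j) :=
    (Finset.eventually_all s).2 fun j _ => eventually_cofinite_shift (hB (i - j)) j
  filter_upwards [h1, h2] with n h1 h2
  rw [opMul_eq_sum hA' hB' hs, conv, finsum_eq_sum_of_support_subset (s := s)]
  · exact Finset.sum_congr rfl fun j hj => by rw [h1 j hj, h2 j hj]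
  · intro j hj
    by_contra hjs
    apply hj
    by_cases h1 : ε * j ≤ k
    · have h2 : ¬ ε * (i - j) ≤ m := fun h2 => hjs (hs j h1 h2)
      simp [hB.eq_zero hB' (not_le.1 h2)]
    · simp [hA.eq_zero hA' (not_le.1 h1)]

namespace DOp

variable {ε : ℤˣ}

theorem symb_mul {a b : ℤ → ℂ} {A B : DOp ε} (hA : Symb a A.op) (hB : Symb b B.op) :
    Symb (conv a b) (A * B).op := by
  obtain ⟨_, h⟩ := A.exists_ordLE
  obtain ⟨_, h'⟩ := B.exists_ordLE
  exact hA.mul hB h h'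

theorem symb_pow {m : ℤ} {c : ℂ} {A : DOp ε} (hA : Symb (Pi.single m c) A.op) (k : ℕ) :
    Symb (Pi.single (k * m) (c ^ k)) (A ^ k).op := by
  induction k with
  | zero => simpa using Symb.one
  | succ k ih =>
    have := symb_mul ih hA
    rw [conv_single, ← pow_succ, ← pow_succ, ← add_one_mul] at this
    exact_mod_cast this

theorem symb_comm {a b : ℤ → ℂ} {A B : DOp ε} (hA : Symb a A.op) (hB : Symb b B.op) :
    Symb 0 (A * B - B * A).op := by
  have := (symb_mul hA hB).sub (symb_mul hB hA)
  rwa [conv_comm b a, sub_self] at this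

theorem symb_zero_mul {b : ℤ → ℂ} {A B : DOp ε} (hA : Symb 0 A.op) (hB : Symb b B.op) :
    Symb 0 (A * B).op := by
  have := symb_mul hA hB
  rwa [conv_comm, conv_zero] at this

theorem symb_mul_zero {a : ℤ → ℂ} {A B : DOp ε} (hA : Symb a A.op) (hB : Symb 0 B.op) :
    Symb 0 (A * B).op := by
  have := symb_mul hA hB
  rwa [conv_zero] at this

end DOp

theorem Symb.finSupp {A : Op} (hA : Symb 0 A) (i : ℤ) : FinSupp (A i) := finSupp_iff.2 (hA i)

/-! ### The trace and its cyclicity -/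

theorem tr_add {A B : Op} (hA : FinSupp (res A)) (hB : FinSupp (res B)) :
    tr (A + B) = tr A + tr B := finsum_add_distrib hA hB

theorem tr_sub {A B : Op} (hA : FinSupp (res A)) (hB : FinSupp (res B)) :
    tr (A - B) = tr A - tr B := finsum_sub_distrib hA hB

theorem tr_smul (c : ℂ) (A : Op) : tr (c • A) = c * tr A := by
  rw [← smul_eq_mul, tr, tr, smul_finsum]; rfl

theorem tr_zero : tr 0 = 0 := finsum_eq_zero_of_forall_eq_zero fun _ => rfl

theorem tr_eq_zero {A : Op} (h : A 0 = 0) : tr A = 0 :=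
  finsum_eq_zero_of_forall_eq_zero fun n => by rw [res, h]; rfl

theorem tr_sum {ι : Type*} (s : Finset ι) {A : ι → Op} (hA : ∀ i ∈ s, FinSupp (res (A i))) :
    tr (∑ i ∈ s, A i) = ∑ i ∈ s, tr (A i) := by
  simp only [tr]
  rw [← finsum_sum_comm s _ hA]
  exact finsum_congr fun n => by simp [res]

/-- The trace of a product is symmetric if one factor has finitely supported coefficients. -/
theorem tr_mul_comm {ε : ℤˣ} {a b : ℤ} {A B : Op} (hA : OrdLE ε a A) (hB : OrdLE ε b B)
    (h : Symb 0 A) : tr (A ⋆ B) = tr (B ⋆ A) := by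
  obtain ⟨s, hs⟩ := exists_window ε a b 0
  have hs' : ∀ j : ℤ, ε * j ≤ b → ε * (0 - j) ≤ a → j ∈ s.image (fun j => -j) := by
    intro j h1 h2
    refine Finset.mem_image.2 ⟨-j, hs _ (by simpa using h2) (by simpa using h1), by simp⟩
  simp only [tr, res, opMul_eq_sum hA hB hs, opMul_eq_sum hB hA hs']
  rw [finsum_sum_comm s, finsum_sum_comm, Finset.sum_image (by simp)]
  · refine Finset.sum_congr rfl fun j _ => ?_
    -- Translating the summation site by j exchanges the roles of the two factors.
    rw [← finsum_comp_equiv (Equiv.addRight j) (f := fun n => B (-j) n * A (0 - -j) (n + -j))]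
    exact finsum_congr fun n => by simp [mul_comm]
  · intro j _
    refine finSupp_iff.2 ?_
    filter_upwards [eventually_cofinite_shift (h (0 - j)) j] with n hn
    rw [hn]
    simp
  · intro j _
    refine finSupp_iff.2 ?_
    filter_upwards [h j] with n hn
    simp [hn]

/-! ### Geometric series and inverses of Lax operators -/

theorem single_opMul_single (i j : ℤ) (f g : ℤ → ℂ) :
    (Pi.single i f : Op) ⋆ (Pi.single j g : Op) = Pi.single (i + j) (fun n => f n * g (n + i)) := by
  funext l n
  rw [opMul, finsum_eq_single _ i]
  · by_cases h : l = i + j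
    · subst h; simp
    · have : l - i ≠ j := by omega
      simp [h, this]
  · intro m hm; simp [hm]

theorem ordLE_single (ε : ℤˣ) {i m : ℤ} (f : ℤ → ℂ) (h : ε * i ≤ m) :
    OrdLE ε m (Pi.single i f : Op) := fun j hj => by
  have : j ≠ i := by rintro rfl; omega
  simp [this]

theorem single_zero_eq_mulOp (f : ℤ → ℂ) : (Pi.single 0 f : Op) = mulOp f := by
  funext i; by_cases h : i = 0
  · subst h; simp [mulOp]
  · simp [mulOp, h]

theorem symb_single {f : ℤ → ℂ} {c : ℂ} (i : ℤ) (h : ∀ᶠ n in cofinite, f n = c) :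
    Symb (Pi.single i c) (Pi.single i f : Op) := fun j => by
  by_cases hj : j = i
  · subst hj; simpa using h
  · simp [hj]

theorem units_mul_self (ε : ℤˣ) : (ε : ℤ) * ε = 1 := Int.units_coe_mul_self ε

namespace DOp

variable {ε : ℤˣ}

theorem ordLE_mul {a b : ℤ} {A B : DOp ε} (hA : OrdLE ε a A.op) (hB : OrdLE ε b B.op) :
    OrdLE ε (a + b) (A * B).op := OrdLE.mul hA hB

theorem ordLE_pow {a : ℤ} {A : DOp ε} (hA : OrdLE ε a A.op) (k : ℕ) :
    OrdLE ε (k * a) (A ^ k).op := by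
  rw [op_pow]; exact hA.pow k

theorem ordLE_one : OrdLE ε 0 (1 : DOp ε).op := OrdLE.mulOp ε 1

/-- The geometric series of an operator of negative order. -/
def geom (T : DOp ε) (hT : OrdLE ε (-1) T.op) : DOp ε :=
  -- T^m has order at most -m, so only m ≤ |i| can contribute to the coefficient of Λ^i.
  mk (m := 0) (fun i n => ∑ m ∈ Finset.range (i.natAbs + 1), (T ^ m).op i n) fun i hi => by
    funext n
    refine Finset.sum_eq_zero fun m _ => ?_
    rw [ordLE_pow hT m i (by omega)]; rfl

theorem geom_sub_ordLE (T : DOp ε) (hT : OrdLE ε (-1) T.op) (M : ℕ) :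
    OrdLE ε (-M) (geom T hT - ∑ m ∈ Finset.range M, T ^ m).op := fun i hi => by
  funext n
  have key : ∑ m ∈ Finset.range (i.natAbs + 1), (T ^ m).op i n
      = ∑ m ∈ Finset.range M, (T ^ m).op i n := by
    by_cases h0 : 0 < ε * i
    · rw [Finset.sum_eq_zero, Finset.sum_eq_zero]
      all_goals
        intro m _
        rw [ordLE_pow hT m i (by omega)]; rfl
    · have hi' : (i.natAbs : ℤ) = -(ε * i) := by
        rcases Int.units_eq_one_or ε with rfl | rfl <;> simp at * <;> omega
      refine Finset.sum_subset (by intro x; simp; omega) fun m _ hm => ?_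
      rw [ordLE_pow hT m i (by simp at hm; omega)]; rfl
  simp only [op_sub, op_sum, Pi.sub_apply, Finset.sum_apply]
  rw [← key]
  exact sub_self _

/-- The filtration by order is separated, so identities for infinite series can be checked modulo
every order -M. -/
theorem eq_of_ordLE {A B : DOp ε} (h : ∀ M : ℕ, OrdLE ε (-M) (A - B).op) : A = B := by
  refine sub_eq_zero.1 (ext (funext fun i => ?_))
  refine h (i.natAbs + 1) i ?_
  have := neg_abs_le i
  have := le_abs_self i
  rcases Int.units_eq_one_or ε with rfl | rfl <;> simp <;> omega

theorem one_sub_mul_geom (T : DOp ε) (hT : OrdLE ε (-1) T.op) : (1 - T) * geom T hT = 1 := by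
  refine eq_of_ordLE fun M => ?_
  have h1 : (1 - T) * geom T hT - 1
      = (1 - T) * (geom T hT - ∑ m ∈ Finset.range M, T ^ m) - T ^ M := by
    rw [mul_sub, mul_neg_geom_sum]; abel
  rw [h1]
  have h2 : OrdLE ε 0 (1 - T).op := ordLE_one.sub (hT.mono (by norm_num))
  exact ((ordLE_mul h2 (geom_sub_ordLE T hT M)).mono (by omega)).sub
    ((ordLE_pow hT M).mono (by omega))

theorem geom_mul_one_sub (T : DOp ε) (hT : OrdLE ε (-1) T.op) : geom T hT * (1 - T) = 1 := by
  refine eq_of_ordLE fun M => ?_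
  have h1 : geom T hT * (1 - T) - 1
      = (geom T hT - ∑ m ∈ Finset.range M, T ^ m) * (1 - T) - T ^ M := by
    rw [sub_mul, geom_sum_mul_neg]; abel
  rw [h1]
  have h2 : OrdLE ε 0 (1 - T).op := ordLE_one.sub (hT.mono (by norm_num))
  exact ((ordLE_mul (geom_sub_ordLE T hT M) h2).mono (by omega)).sub
    ((ordLE_pow hT M).mono (by omega))

theorem symb_geom {T : DOp ε} (hT : OrdLE ε (-1) T.op) (h : Symb 0 T.op) :
    Symb (Pi.single 0 1) (geom T hT).op := fun i => by
  have h1 : ∀ m ∈ Finset.range i.natAbs, ∀ᶠ n in cofinite, (T ^ (m + 1)).op i n = 0 := by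
    intro m _
    have h' : Symb (Pi.single 0 0) T.op := by simpa using h
    simpa using symb_pow h' (m + 1) i
  filter_upwards [(Finset.eventually_all _).2 h1, Symb.one i] with n h1 h2
  change ∑ m ∈ Finset.range (i.natAbs + 1), (T ^ m).op i n = _
  rw [Finset.sum_range_succ', Finset.sum_eq_zero h1, zero_add, ← h2]
  rfl

/-- Operators `w Λ^ε + ⋯` with an invertible leading coefficient, constant up to finitely supported
functions. -/
structure IsLax (c : ℂ) (L : DOp ε) : Prop where
  ord : OrdLE ε 1 L.op
  symb : Symb (Pi.single (ε : ℤ) c) L.op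
  ne : ∀ n, L.op ε n ≠ 0

variable {c : ℂ} {L : DOp ε}

theorem IsLax.lead (h : IsLax c L) : ∀ᶠ n in cofinite, L.op ε n = c := by
  simpa using h.symb ε

theorem IsLax.const_ne (h : IsLax c L) : c ≠ 0 := by
  obtain ⟨n, hn⟩ := h.lead.exists
  exact hn ▸ h.ne n

/-- Factor out the leading term W: L = W(1 - T) with T of negative order, so the inverse is the
geometric series of T times W⁻¹. The symbol of T vanishes, which keeps the coefficients of the
inverse almost constant. -/
theorem IsLax.exists_inverse (h : IsLax c L) : ∃ Y : DOp ε, L * Y = 1 ∧ Y * L = 1 ∧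
    OrdLE ε (-1) Y.op ∧ Symb (Pi.single (-(ε : ℤ)) c⁻¹) Y.op := by
  set W : DOp ε := DOp.mk (Pi.single (ε : ℤ) (L.op ε) : Op) (ordLE_single ε _ (units_mul_self ε).le)
  -- The shift by -ε comes from moving Λ^(-ε) past the inverse of the leading coefficient.
  set w : ℤ → ℂ := fun n => (L.op ε (n + -ε))⁻¹
  have hw : OrdLE ε (-1) (Pi.single (-(ε : ℤ)) w : Op) :=
    ordLE_single ε _ (by rw [mul_neg, units_mul_self])
  set W' : DOp ε := DOp.mk (Pi.single (-(ε : ℤ)) w : Op) hw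
  have h1 : W * W' = 1 := by
    ext1
    simp only [W, W', op_mul, op_mk, op_one, single_opMul_single, w]
    rw [add_neg_cancel, single_zero_eq_mulOp]
    congr 1; funext n
    simp [h.ne n]
  have h2 : W' * W = 1 := by
    ext1
    simp only [W, W', op_mul, op_mk, op_one, single_opMul_single, w]
    rw [neg_add_cancel, single_zero_eq_mulOp]
    congr 1; funext n
    simp [h.ne]
  have hW' : Symb (Pi.single (-(ε : ℤ)) c⁻¹) W'.op := by
    refine symb_single _ ?_
    filter_upwards [eventually_cofinite_shift h.lead (-ε)] with n hn
    simp [w, hn]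
  have hsymb : Symb (Pi.single 0 1) (W' * L).op := by
    have := symb_mul hW' h.symb
    rwa [conv_single, neg_add_cancel, inv_mul_cancel₀ h.const_ne] at this
  -- The product W'L has order at most 0 and degree-zero coefficient 1, so this coefficient cancels.
  have hT : OrdLE ε (-1) (1 - W' * L).op := by
    intro i hi
    have hle : OrdLE ε 0 (1 - W' * L).op :=
      ordLE_one.sub ((ordLE_mul hw h.ord).mono (by norm_num))
    by_cases h0 : 0 < ε * i
    · exact hle i h0
    · have h0 : i = 0 := by
        have : (ε : ℤ) * i = 0 := by omega
        simpa using this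
      subst h0
      funext n
      have := opMul_top hw h.ord n
      simp only [neg_add_cancel, mul_zero, mul_neg, mul_one] at this
      simp only [op_sub, op_mul, Pi.sub_apply, op_one]
      change mulOp 1 0 n - ((Pi.single (-(ε : ℤ)) w : Op) ⋆ L.op) 0 n = 0
      rw [this]
      simp [mulOp, w, h.ne]
  have hTs : Symb 0 (1 - W' * L).op := by
    have := Symb.one.sub hsymb
    rwa [sub_self] at this
  have e1 := one_sub_mul_geom _ hT
  have e2 := geom_mul_one_sub _ hT
  have e3 := symb_geom hT hTs
  have e4 : OrdLE ε 0 (geom _ hT).op := fun i hi => by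
    have := geom_sub_ordLE _ hT 0
    exact by simpa using this i (by simpa using hi)
  rw [sub_sub_cancel] at e1 e2
  set G := geom _ hT
  refine ⟨G * W', ?_, ?_, ?_, ?_⟩
  · calc L * (G * W') = W * W' * L * G * W' := by rw [h1]; noncomm_ring
      _ = W * (W' * L * G) * W' := by noncomm_ring
      _ = 1 := by rw [e1, mul_one, h1]
  · rw [mul_assoc, e2]
  · exact (OrdLE.mul e4 hw).mono (by norm_num)
  · simpa [conv_single] using symb_mul e3 hW'

/-- The operator `L^(k-N)`. -/
theorem IsLax.exists_pow_sub (h : IsLax c L) (k N : ℕ) : ∃ B : DOp ε, Commute B L ∧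
    B * L ^ N = L ^ k ∧ OrdLE ε (k - N) B.op ∧
    ∃ d : ℂ, Symb (Pi.single (ε * (k - N) : ℤ) d) B.op := by
  obtain ⟨Y, h1, h2, h3, h4⟩ := h.exists_inverse
  have hYL : Commute Y L := h2.trans h1.symm
  refine ⟨L ^ k * Y ^ N, ?_, ?_, ?_, c ^ k * c⁻¹ ^ N, ?_⟩
  · exact ((Commute.refl L).pow_left k).mul_left (hYL.pow_left N)
  · rw [mul_assoc, ← hYL.mul_pow, h2, one_pow, mul_one]
  · exact (ordLE_mul (ordLE_pow h.ord k) (ordLE_pow h3 N)).mono (by omega)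
  · have := symb_mul (symb_pow h.symb k) (symb_pow h4 N)
    rw [conv_single] at this
    convert this using 2
    ring

theorem IsLax.pow_top_ne (h : IsLax c L) (k : ℕ) (n : ℤ) : (L ^ k).op (ε * k) n ≠ 0 := by
  induction k generalizing n with
  | zero => simp [mulOp]
  | succ k ih =>
    have := opMul_top (ordLE_pow h.ord k) h.ord n
    simp only [mul_one] at this
    rw [pow_succ, op_mul, Nat.cast_succ, this]
    exact mul_ne_zero (ih n) (h.ne _)

end DOp

/-! ### First variations and the differentials of the Hamiltonians -/

/-- The part of `A` of orders greater than `m` with respect to the degree `ε * i` of `Λ^i`. -/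
def partGT (ε : ℤˣ) (m : ℤ) (A : Op) : Op := fun i => if m < ε * i then A i else 0

theorem FinSupp.add {f g : ℤ → ℂ} (hf : FinSupp f) (hg : FinSupp g) : FinSupp (f + g) :=
  (Set.Finite.union hf hg).subset (Function.support_add f g)

theorem Symb.finSupp_smul {A : Op} (hA : Symb 0 A) (s : ℂ) (i : ℤ) : FinSupp ((s • A) i) :=
  finSupp_iff.2 (by simpa using hA.smul s i)

namespace DOp

variable {ε : ℤˣ} {c : ℂ} {L : DOp ε}

theorem IsLax.mul_right_cancel (h : IsLax c L) {A B : DOp ε} (e : A * L = B * L) : A = B := by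
  obtain ⟨Y, h1, -⟩ := h.exists_inverse
  rw [← mul_one A, ← mul_one B, ← h1, ← mul_assoc, ← mul_assoc, e]

/-- First variation of `L ^ k`. -/
def dpow (L V : DOp ε) (k : ℕ) : DOp ε := ∑ a ∈ Finset.range k, L ^ a * V * L ^ (k - 1 - a)

theorem op_dpow (L V : DOp ε) (k : ℕ) : (dpow L V k).op = powVar k L.op V.op :=
  op_powVar k L V

theorem dpow_succ (L V : DOp ε) (k : ℕ) : dpow L V (k + 1) = dpow L V k * L + L ^ k * V := by
  rw [dpow, Finset.sum_range_succ, dpow, Finset.sum_mul]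
  congr 1
  · refine Finset.sum_congr rfl fun a ha => ?_
    rw [mul_assoc _ _ L, ← pow_succ]
    congr 2
    have := Finset.mem_range.1 ha
    omega
  · simp

/-- The commutator with `B` is a derivation. -/
theorem dpow_comm (L B : DOp ε) (k : ℕ) :
    dpow L (B * L - L * B) k = B * L ^ k - L ^ k * B := by
  induction k with
  | zero => simp [dpow]
  | succ k ih => rw [dpow_succ, ih, pow_succ]; noncomm_ring

theorem symb_zero_dpow {V : DOp ε} (hL : IsLax c L) (hV : Symb 0 V.op) (k : ℕ) :
    Symb 0 (dpow L V k).op := by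
  rw [dpow, op_sum]
  have := Symb.sum (s := Finset.range k) (a := fun _ => 0)
    (A := fun a => (L ^ a * V * L ^ (k - 1 - a)).op) fun a _ =>
    symb_zero_mul (symb_mul_zero (symb_pow hL.symb a) hV) (symb_pow hL.symb _)
  simpa using this

theorem ordLE_dpow {V : DOp ε} {δ : ℤ} (hL : IsLax c L) (hV : OrdLE ε δ V.op) (k : ℕ) :
    OrdLE ε (k - 1 + δ) (dpow L V k).op := by
  rw [dpow, op_sum]
  refine OrdLE.sum fun a ha => ?_
  have := Finset.mem_range.1 ha
  exact (ordLE_mul (ordLE_mul (ordLE_pow hL.ord a) hV) (ordLE_pow hL.ord _)).mono (by omega)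

/-- Polynomials in a complex parameter whose coefficients are operators with finitely supported
coefficients. -/
inductive IsPoly : (ℂ → DOp ε) → Prop
  | const {C : DOp ε} (h : Symb 0 C.op) : IsPoly fun _ => C
  | add {g g' : ℂ → DOp ε} : IsPoly g → IsPoly g' → IsPoly fun s => g s + g' s
  | smul {g : ℂ → DOp ε} : IsPoly g → IsPoly fun s => s • g s

theorem IsPoly.mul_right {g : ℂ → DOp ε} (hg : IsPoly g) {b : ℤ → ℂ} {B : DOp ε}
    (hB : Symb b B.op) : IsPoly fun s => g s * B := by
  induction hg with
  | const h => exact .const (symb_zero_mul h hB)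
  | add _ _ h1 h2 => simpa only [add_mul] using h1.add h2
  | smul _ h => simpa only [smul_mul_assoc] using h.smul

theorem IsPoly.symb {g : ℂ → DOp ε} (hg : IsPoly g) (s : ℂ) : Symb 0 (g s).op := by
  induction hg with
  | const h => exact h
  | add _ _ h1 h2 => simpa using h1.add h2
  | smul _ h => simpa using h.smul s

theorem IsPoly.differentiable {g : ℂ → DOp ε} (hg : IsPoly g) :
    Differentiable ℂ fun s => tr (g s).op := by
  induction hg with
  | const h => exact differentiable_const _
  | add h h' h1 h2 =>
    have : ∀ s, tr (_ + _ : DOp ε).op = _ := fun s =>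
      tr_add ((h.symb s).finSupp 0) ((h'.symb s).finSupp 0)
    simp only [this]
    exact h1.add h2
  | smul _ h =>
    simp only [op_smul, tr_smul]
    exact differentiable_id.mul h

/-- The remainder is kept as a polynomial in s with finitely supported coefficients so that its
trace is differentiable; the factor s² then removes it from the derivative at 0. -/
theorem IsLax.exists_pow_add_smul (hL : IsLax c L) {V : DOp ε} (hV : Symb 0 V.op) (k : ℕ) :
    ∃ E : ℂ → DOp ε, IsPoly E ∧
      ∀ s : ℂ, (L + s • V) ^ k = L ^ k + s • dpow L V k + s ^ 2 • E s := by
  induction k with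
  | zero => exact ⟨fun _ => 0, .const Symb.zero, fun s => by simp [dpow]⟩
  | succ k ih =>
    obtain ⟨E, hE, h⟩ := ih
    refine ⟨fun s => (E s * L + dpow L V k * V) + s • (E s * V),
      ((hE.mul_right hL.symb).add
        (.const (symb_mul_zero (symb_zero_dpow hL hV k) hV))).add
        (hE.mul_right hV).smul, fun s => ?_⟩
    rw [pow_succ, h, dpow_succ, pow_succ L]
    simp only [add_mul, mul_add, smul_mul_assoc, mul_smul_comm, smul_add, smul_smul]
    rw [← sq, ← pow_succ, ← pow_succ']
    abel

theorem mul_comm_tr {A B : DOp ε} (h : Symb 0 A.op) : tr (A * B).op = tr (B * A).op := by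
  obtain ⟨a, ha⟩ := A.exists_ordLE
  obtain ⟨b, hb⟩ := B.exists_ordLE
  exact tr_mul_comm ha hb h

/-- Each trailing power of L is moved cyclically to the front, which is allowed because the
remaining factor contains the finitely supported V. This exposes the adjoint of the first variation.
-/
theorem IsLax.tr_mul_dpow (hL : IsLax c L) {b : ℤ → ℂ} {B V : DOp ε} (hB : Symb b B.op)
    (hV : Symb 0 V.op) (k : ℕ) : tr (B * dpow L V k).op
      = ∑ a ∈ Finset.range k, tr (L ^ (k - 1 - a) * B * L ^ a * V).op := by
  rw [dpow, Finset.mul_sum, op_sum, tr_sum]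
  · refine Finset.sum_congr rfl fun a _ => ?_
    rw [show B * (L ^ a * V * L ^ (k - 1 - a)) = (B * L ^ a * V) * L ^ (k - 1 - a) by
      noncomm_ring, mul_comm_tr]
    · noncomm_ring
    · exact symb_mul_zero (symb_mul hB (symb_pow hL.symb a)) hV
  · intro a _
    exact (symb_mul_zero hB (symb_zero_mul (symb_mul_zero (symb_pow hL.symb a) hV)
      (symb_pow hL.symb _))).finSupp 0

theorem IsLax.tr_commute_mul_dpow (hL : IsLax c L) {b : ℤ → ℂ} {B V : DOp ε}
    (hB : Symb b B.op) (hBL : Commute B L) (hV : Symb 0 V.op) (k : ℕ) :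
    tr (B * dpow L V k).op = k * tr (B * L ^ (k - 1) * V).op := by
  rw [hL.tr_mul_dpow hB hV, Finset.sum_congr rfl (g := fun _ => tr (B * L ^ (k - 1) * V).op)]
  · simp
  · intro a ha
    have := Finset.mem_range.1 ha
    rw [(hBL.pow_right _).symm.eq, mul_assoc B, ← pow_add]
    congr 6
    omega

theorem IsLax.hasDerivAt_tr_pow (hL : IsLax c L) {V : DOp ε} (hV : Symb 0 V.op) {k : ℕ}
    (hk : 0 < k) : HasDerivAt (fun s : ℂ => tr (opPow (L.op + s • V.op) k))
      (k * tr (L ^ (k - 1) * V).op) 0 := by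
  obtain ⟨E, hE, h⟩ := hL.exists_pow_add_smul hV k
  have hD := symb_zero_dpow hL hV k
  -- The symbol of L^k sits at order εk, which is nonzero for k > 0. Finite support of the residue
  -- makes `tr` additive here; a sum with infinite support would default to 0.
  have h0 : FinSupp (res (L ^ k).op) := by
    refine finSupp_iff.2 ?_
    have := symb_pow hL.symb k 0
    have h' : (0 : ℤ) ≠ k * ε := by
      have : (k : ℤ) ≠ 0 := by omega
      exact (mul_ne_zero this ε.ne_zero).symm
    rwa [Pi.single_eq_of_ne h'] at this
  have key : ∀ s : ℂ, tr (opPow (L.op + s • V.op) k)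
      = tr (L ^ k).op + s * tr (dpow L V k).op + s ^ 2 * tr (E s).op := by
    intro s
    rw [← op_smul, ← op_add, ← op_pow, h, op_add, op_add, op_smul, op_smul, tr_add, tr_add,
      tr_smul, tr_smul]
    · exact h0
    · exact hD.finSupp_smul s 0
    · exact FinSupp.add h0 (hD.finSupp_smul s 0)
    · exact (hE.symb s).finSupp_smul (s ^ 2) 0
  simp only [key]
  have h1 : tr (dpow L V k).op = k * tr (L ^ (k - 1) * V).op := by
    have := hL.tr_commute_mul_dpow Symb.one (Commute.one_left L) hV k
    simpa only [one_mul] using this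
  rw [← h1]
  have d1 := ((hasDerivAt_id (0 : ℂ)).mul_const (tr (dpow L V k).op)).const_add (tr (L ^ k).op)
  have d2 := ((hasDerivAt_id (0 : ℂ)).pow 2).mul (hE.differentiable 0).hasDerivAt
  exact (d1.add d2).congr_deriv (by simp)

theorem partGT_ordLE {A : DOp ε} {m : ℤ} : OrdLE ε m (A.op - partGT ε m A.op) := fun i hi => by
  simp [partGT, hi]

/-- Since B commutes with L and B L^(N-1) = L^(k-1), pairing B with the variation of L^N gives
N⟨L^(k-1) V⟩. The factor N/k in the Hamiltonian cancels the k from differentiating the trace of L^k.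
-/
theorem IsLax.hasDerivAt_hamiltonian (hL : IsLax c L) {N k : ℕ} (hN : 0 < N) (hk : 0 < k)
    {b : ℤ → ℂ} {B V : DOp ε} (hB : Symb b B.op) (hBL : Commute B L) (hBN : B * L ^ N = L ^ k)
    {δ : ℤ} (hV : Symb 0 V.op) (hVδ : OrdLE ε δ V.op) :
    HasDerivAt (fun s : ℂ => (N : ℂ) / k * tr (opPow (L.op + s • V.op) k))
      (tr (partGT ε (-N - δ) B.op ⋆ powVar N L.op V.op)) 0 := by
  have h1 : B * L ^ (N - 1) = L ^ (k - 1) := by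
    apply hL.mul_right_cancel
    rw [mul_assoc, ← pow_succ, ← pow_succ, Nat.sub_add_cancel hN, Nat.sub_add_cancel hk, hBN]
  have hD := symb_zero_dpow hL hV N
  set R : DOp ε := DOp.mk _ (partGT_ordLE (A := B) (m := -N - δ)) with hR
  have h2 : tr (partGT ε (-N - δ) B.op ⋆ powVar N L.op V.op) = tr (B * dpow L V N).op := by
    have e : partGT ε (-N - δ) B.op ⋆ powVar N L.op V.op
        = (B * dpow L V N).op - (R * dpow L V N).op := by
      rw [← op_sub, ← sub_mul, op_mul, op_dpow]
      simp [hR]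
    -- The discarded tail has order at most -N-δ and the variation order at most N-1+δ, so their
    -- product has order at most -1 and no residue.
    have hz : (R * dpow L V N).op 0 = 0 := by
      have hRo : OrdLE ε (-N - δ) R.op := partGT_ordLE
      exact ordLE_mul hRo (ordLE_dpow hL hVδ N) 0 (by simp)
    rw [e, tr_sub, tr_eq_zero hz, sub_zero]
    · exact (symb_mul_zero hB hD).finSupp 0
    · rw [res, hz]; exact Symb.zero.finSupp 0
  rw [h2, hL.tr_commute_mul_dpow hB hBL hV, h1]
  refine ((hL.hasDerivAt_tr_pow hV hk).const_mul ((N : ℂ) / k)).congr_deriv ?_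
  have : (k : ℂ) ≠ 0 := by exact_mod_cast hk.ne'
  field_simp

/-! ### Nondegeneracy of the pairing with first variations -/

variable {ε : ℤˣ} {c : ℂ} {L : DOp ε}

/-- The sum ∑ L^a Z L^(k-1-a) telescopes under commutation with L. -/
theorem comm_dpow (L Z : DOp ε) (k : ℕ) :
    L * dpow L Z k - dpow L Z k * L = L ^ k * Z - Z * L ^ k := by
  induction k with
  | zero => simp [dpow]
  | succ k ih =>
    rw [dpow_succ, show L * (dpow L Z k * L + L ^ k * Z) - (dpow L Z k * L + L ^ k * Z) * L
      = (L * dpow L Z k - dpow L Z k * L) * L + L * L ^ k * Z - L ^ k * Z * L by noncomm_ring,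
      ih, pow_succ', (Commute.self_pow L k).eq]
    noncomm_ring

theorem mul_top {a b : ℤ} {A B : DOp ε} (hA : OrdLE ε a A.op) (hB : OrdLE ε b B.op) (n : ℤ) :
    (A * B).op (ε * (a + b)) n = A.op (ε * a) n * B.op (ε * b) (n + ε * a) :=
  opMul_top hA hB n

/-- The leading coefficient of a first variation, far out on the lattice. -/
theorem IsLax.dpow_lead (hL : IsLax c L) {Z : DOp ε} {m : ℤ} {d : ℂ} (hZ : OrdLE ε m Z.op)
    (hd : ∀ᶠ n in cofinite, Z.op (ε * m) n = d) (k : ℕ) :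
    ∀ᶠ n in cofinite, (dpow L Z k).op (ε * (k - 1 + m)) n = k * c ^ (k - 1) * d := by
  induction k with
  | zero => simp [dpow]
  | succ k ih =>
    have h2 : ∀ᶠ n in cofinite, (L ^ k).op (ε * (k * 1)) n = c ^ k := by
      have := symb_pow hL.symb k (ε * (k * 1))
      simpa [mul_comm (ε : ℤ)] using this
    filter_upwards [ih, h2, eventually_cofinite_shift hL.lead (ε * (k - 1 + m)),
      eventually_cofinite_shift hd (ε * (k * 1))] with n h3 h4 h5 h6
    have e1 := mul_top (ordLE_dpow hL hZ k) hL.ord n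
    have e2 := mul_top (ordLE_pow hL.ord k) hZ n
    rw [mul_one, h3, h5] at e1
    rw [h4, h6] at e2
    rw [dpow_succ, op_add, Pi.add_apply, Pi.add_apply,
      show (ε : ℤ) * ((k + 1 : ℕ) - 1 + m) = ε * (k - 1 + m + 1) by push_cast; ring, e1,
      show (ε : ℤ) * (k - 1 + m + 1) = ε * (k * 1 + m) by ring, e2]
    cases k with
    | zero => simp
    | succ k => simp; ring

/-- A finite-order operator with almost constant coefficients, orthogonal to the first variations
of `L ^ N`, vanishes. -/
theorem IsLax.eq_zero_of_tr_mul_dpow (hL : IsLax c L) {N : ℕ} (hN : 0 < N) {δ : ℤ} {Z : DOp ε}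
    {a : ℤ → ℂ} (ha : Symb a Z.op) (hbot : ∀ i : ℤ, ε * i ≤ -N - δ → Z.op i = 0)
    (h : ∀ V : DOp ε, OrdLE ε δ V.op → Symb 0 V.op → tr (Z * dpow L V N).op = 0) : Z.op = 0 := by
  by_contra hne
  obtain ⟨i, hi⟩ := Function.ne_iff.1 hne
  obtain ⟨K, hK⟩ := Z.exists_ordLE
  -- The argument concerns the leading order m of a supposed nonzero Z.
  obtain ⟨m, hm, hmax⟩ := Int.exists_greatest_of_bdd (P := fun m => Z.op (ε * m) ≠ 0)
    ⟨K, fun z hz => not_lt.1 fun hlt => hz (hK _ (by rwa [units_mul_mul]))⟩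
    ⟨ε * i, by rwa [units_mul_mul]⟩
  have hZ : OrdLE ε m Z.op := fun j hj => by
    by_contra hj'
    exact absurd (hmax (ε * j) (by rwa [units_mul_mul])) (not_le.2 hj)
  have hmδ : -N - δ < m := by
    by_contra hle
    exact hm (hbot _ (by rw [units_mul_mul]; omega))
  have hYo := ordLE_dpow hL hZ N
  have hY : ∀ n, (dpow L Z N).op (ε * (N - 1 + m)) n = 0 := by
    intro n₀
    set q : ℤ := N - 1 + m
    -- A test variation of the order opposite to the leading order q of ∑ L^a Z L^(N-1-a),
    -- concentrated at one site so that the trace reads off its leading coefficient at n₀. It is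
    -- admissible because m > -N-δ means -q ≤ δ.
    set v : Op := Pi.single (ε * -q) (Pi.single (n₀ + ε * q) 1)
    have hv : OrdLE ε (-q) v := ordLE_single ε _ (by rw [units_mul_mul])
    have hv0 : Symb 0 v := by
      have := symb_single (f := (Pi.single (n₀ + ε * q) 1 : ℤ → ℂ)) (c := 0) (ε * -q) (by
        filter_upwards [(Set.finite_singleton (n₀ + ε * q)).compl_mem_cofinite] with n hn
        exact Pi.single_eq_of_ne hn 1)
      rwa [Pi.single_zero] at this
    have h1 := h (DOp.mk v hv) (hv.mono (by omega)) hv0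
    -- Reflecting a to N-1-a turns the cyclically rotated sum into the first variation with Z in
    -- place of V.
    rw [hL.tr_mul_dpow (V := DOp.mk v hv) ha hv0, ← Finset.sum_range_reflect, ← tr_sum, ← op_sum, ← Finset.sum_mul,
      Finset.sum_congr rfl (g := fun a => L ^ a * Z * L ^ (N - 1 - a))] at h1
    · change tr (dpow L Z N * DOp.mk v hv).op = 0 at h1
      rw [tr, finsum_eq_single _ n₀] at h1
      · have := mul_top (B := DOp.mk v hv) hYo hv n₀
        rw [add_neg_cancel, mul_zero] at this
        rw [res, this] at h1
        simpa [v] using h1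
      · intro n hn
        have := mul_top (B := DOp.mk v hv) hYo hv n
        rw [add_neg_cancel, mul_zero] at this
        rw [res, this]
        have hn' : n + ε * q ≠ n₀ + ε * q := by omega
        simp [v, hn']
    · intro a ha
      have := Finset.mem_range.1 ha
      congr 3
      omega
    · intro a _
      exact (symb_mul_zero (B := DOp.mk v hv) (symb_mul (symb_mul (symb_pow hL.symb _) ha)
        (symb_pow hL.symb _)) hv0).finSupp 0
  -- Far out, the vanishing leading coefficient equals N c^(N-1) times the constant value of the
  -- leading coefficient of Z, so that value is zero.
  have hd : a (ε * m) = 0 := by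
    obtain ⟨n, hn⟩ := (hL.dpow_lead hZ (ha (ε * m)) N).exists
    rw [hY] at hn
    have : (N : ℂ) ≠ 0 := by exact_mod_cast hN.ne'
    simpa [this, hL.const_ne] using hn.symm
  -- Compare the coefficients of degree N + m in [L, ∑ L^a Z L^(N-1-a)] = [L^N, Z]; the left side
  -- vanishes there.
  have hrec : ∀ n, (L ^ N).op (ε * N) n * Z.op (ε * m) (n + ε * N)
      = Z.op (ε * m) n * (L ^ N).op (ε * N) (n + ε * m) := by
    intro n
    have hP := ordLE_pow hL.ord N
    have e1 := mul_top hP hZ n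
    have e2 := mul_top hZ hP n
    have e3 := mul_top hL.ord hYo n
    have e4 := mul_top hYo hL.ord n
    rw [hY, mul_zero] at e3
    rw [hY, zero_mul] at e4
    rw [mul_one] at e1 e2
    rw [← e1, ← e2, ← sub_eq_zero]
    have := congrFun (congrFun (congrArg op (comm_dpow L Z N)) (ε * (N + m))) n
    simp only [op_sub, Pi.sub_apply] at this
    rw [add_comm m, ← this]
    rw [show (1 : ℤ) + (N - 1 + m) = N + m by ring] at e3
    rw [show (N : ℤ) - 1 + m + 1 = N + m by ring] at e4
    rw [e3, e4, sub_zero]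
  apply hm
  funext n
  by_contra hn
  -- The leading coefficient of L^N vanishes nowhere, so the recursion carries nonvanishing from
  -- each site to the next one at distance N.
  have hall : ∀ j : ℕ, Z.op (ε * m) (n + j * (ε * N)) ≠ 0 := by
    intro j
    induction j with
    | zero => simpa using hn
    | succ j ih =>
      have h1 := hrec (n + j * (ε * N))
      have h2 := mul_ne_zero ih (hL.pow_top_ne N (n + j * (ε * N) + ε * m))
      rw [← h1] at h2
      have := right_ne_zero_of_mul h2
      rwa [show n + j * (ε * N) + ε * N = n + ((j + 1 : ℕ) : ℤ) * (ε * N) by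
        push_cast; ring] at this
  have hinj : Function.Injective fun j : ℕ => n + (j : ℤ) * (ε * N) := by
    intro j j' hj
    have : (ε : ℤ) * N ≠ 0 := mul_ne_zero ε.ne_zero (by omega)
    simpa [this, hN.ne'] using hj
  have hev := ha (ε * m)
  rw [hd] at hev
  obtain ⟨j, hj⟩ := (hinj.tendsto_cofinite.eventually hev).exists
  exact hall j hj

end DOp

/-! ### Truncations and the tensors at one-sided covectors -/

theorem comm_add_left {ε : ℤˣ} {a b c : ℤ} {A B C : Op} (hA : OrdLE ε a A) (hB : OrdLE ε b B)
    (hC : OrdLE ε c C) : comm (A + B) C = comm A C + comm B C := by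
  rw [comm, add_opMul hA hB hC, opMul_add hA hB hC, comm, comm]; abel

theorem comm_smul_left (c : ℂ) (A B : Op) : comm (c • A) B = c • comm A B := by
  rw [comm, smul_opMul, opMul_smul, ← smul_sub, comm]

theorem comm_neg_left (A B : Op) : comm (-A) B = -comm A B := by
  rw [← neg_one_smul ℂ, comm_smul_left, neg_one_smul]

theorem comm_zero_left (A : Op) : comm 0 A = 0 := by
  rw [comm, zero_opMul, opMul_zero, sub_zero]

theorem comm_ordLE {ε : ℤˣ} {a b : ℤ} {A B : Op} (hA : OrdLE ε a A) (hB : OrdLE ε b B) :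
    OrdLE ε (a + b) (comm A B) :=
  (hA.mul hB).sub ((hB.mul hA).mono (by omega))

theorem partGE_add_partLT (k : ℤ) (A : Op) : partGE k A + partLT k A = A := by
  funext i
  by_cases h : k ≤ i
  · simp [partGE, partLT, h, not_lt.2 h]
  · simp [partGE, partLT, h, not_le.1 h]

theorem partGE_zero_right (k : ℤ) : partGE k 0 = 0 := by
  funext i; simp [partGE]

theorem partLT_zero_right (k : ℤ) : partLT k 0 = 0 := by
  funext i; simp [partLT]

theorem OrdLE.partGE {ε : ℤˣ} {m : ℤ} {A : Op} (h : OrdLE ε m A) (k : ℤ) :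
    OrdLE ε m (partGE k A) := fun i hi => by simp [Toda.partGE, h i hi]

theorem OrdLE.partLT {ε : ℤˣ} {m : ℤ} {A : Op} (h : OrdLE ε m A) (k : ℤ) :
    OrdLE ε m (partLT k A) := fun i hi => by simp [Toda.partLT, h i hi]

theorem OrdLE.partGT {ε : ℤˣ} {m : ℤ} {A : Op} (h : OrdLE ε m A) (k : ℤ) :
    OrdLE ε m (partGT ε k A) := fun i hi => by simp [Toda.partGT, h i hi]

/-- This bound needs nothing of A, which is why (L^k)_{≥0} may be multiplied with L̂; `partLT_ordLE`
plays the same role for (L̂^k)_{<0} and L. -/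
theorem partGE_ordLE (k : ℤ) (A : Op) : OrdLE (-1) (-k) (partGE k A) := fun i hi => by
  have : ¬ k ≤ i := by simp at hi; omega
  simp [partGE, this]

theorem partLT_ordLE (k : ℤ) (A : Op) : OrdLE 1 (k - 1) (partLT k A) := fun i hi => by
  have : ¬ i < k := by simp at hi; omega
  simp [partLT, this]

theorem Symb.partGE {a : ℤ → ℂ} {A : Op} (h : Symb a A) (k : ℤ) :
    Symb (fun i => if k ≤ i then a i else 0) (partGE k A) := fun i => by
  by_cases hi : k ≤ i
  · simpa [Toda.partGE, hi] using h i
  · simp [Toda.partGE, hi]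

theorem Symb.partLT {a : ℤ → ℂ} {A : Op} (h : Symb a A) (k : ℤ) :
    Symb (fun i => if i < k then a i else 0) (partLT k A) := fun i => by
  by_cases hi : i < k
  · simpa [Toda.partLT, hi] using h i
  · simp [Toda.partLT, hi]

theorem Symb.partGT {a : ℤ → ℂ} {A : Op} (h : Symb a A) (ε : ℤˣ) (k : ℤ) :
    Symb (fun i => if k < ε * i then a i else 0) (partGT ε k A) := fun i => by
  by_cases hi : k < ε * i
  · simpa [Toda.partGT, hi] using h i
  · simp [Toda.partGT, hi]

theorem OrdLE.partGE_eq_zero {m k : ℤ} {A : Op} (h : OrdLE 1 m A) (hk : m < k) :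
    Toda.partGE k A = 0 := by
  funext i
  by_cases hi : k ≤ i
  · simp [Toda.partGE, h i (by simp; omega)]
  · simp [Toda.partGE, hi]

theorem OrdLE.partLT_eq_zero {m k : ℤ} {A : Op} (h : OrdLE (-1) m A) (hk : m ≤ -k) :
    Toda.partLT k A = 0 := by
  funext i
  by_cases hi : i < k
  · simp [Toda.partLT, h i (by simp; omega)]
  · simp [Toda.partLT, hi]

theorem OrdLE.partLT_eq_self {m k : ℤ} {A : Op} (h : OrdLE 1 m A) (hk : m < k) :
    Toda.partLT k A = A := by
  have := partGE_add_partLT k A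
  rwa [h.partGE_eq_zero hk, zero_add] at this

theorem OrdLE.partGE_eq_self {m k : ℤ} {A : Op} (h : OrdLE (-1) m A) (hk : m ≤ -k) :
    Toda.partGE k A = A := by
  have := partGE_add_partLT k A
  rwa [h.partLT_eq_zero hk, add_zero] at this

/-- Both sides equal X A² - A² X. -/
theorem anticomm_comm {ε : ℤˣ} {a b : ℤ} {A X : Op} (hA : OrdLE ε a A) (hX : OrdLE ε b X) :
    A ⋆ comm X A + comm X A ⋆ A = comm (A ⋆ X + X ⋆ A) A := by
  have : ∀ A X : DOp ε, A * (X * A - A * X) + (X * A - A * X) * A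
      = (A * X + X * A) * A - A * (A * X + X * A) := fun A X => by noncomm_ring
  exact congrArg DOp.op (this (DOp.mk A hA) (DOp.mk X hX))

/-- When Q = [X, A] has no positive orders it enters the first slot whole, where -[X_{<0}, A] + [X,
A] = [X_{≥0}, A], and drops out of the second. -/
theorem tensor1_left {A A' X : Op} {a b : ℤ} (hA : OrdLE 1 a A) (hX : OrdLE 1 b X)
    (hQ : OrdLE 1 0 (comm X A)) :
    tensor1 (A, A') (X, 0) = (comm (partGE 0 X) A, comm (partGE 0 X) A') := by
  simp only [tensor1, commSum, comm_zero_left, add_zero, partLT_zero_right, partGE_zero_right,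
    sub_zero]
  rw [hQ.partLT_eq_self (by norm_num), hQ.partGE_eq_zero (by norm_num), sub_zero]
  congr 1
  conv_lhs => rw [← partGE_add_partLT 0 X, comm_add_left (hX.partGE 0) (hX.partLT 0) hA]
  rw [partGE_add_partLT, comm_neg_left]
  abel

theorem tensor1_right {A A' X : Op} {a b : ℤ} (hA : OrdLE (-1) a A') (hX : OrdLE (-1) b X)
    (hQ : OrdLE (-1) (-1) (comm X A')) :
    tensor1 (A, A') (0, X) = (comm (-partLT 0 X) A, comm (-partLT 0 X) A') := by
  simp only [tensor1, commSum, comm_zero_left, zero_add, partLT_zero_right, partGE_zero_right,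
    neg_zero, zero_sub]
  rw [hQ.partGE_eq_self (by norm_num), hQ.partLT_eq_zero (by norm_num), add_zero]
  congr 1
  conv_lhs =>
    rhs
    rw [← partGE_add_partLT 0 X, comm_add_left (hX.partGE 0) (hX.partLT 0) hA]
  rw [comm_neg_left]
  abel

/-- With Q of order at most 0, `anticomm_comm` turns AQ + QA into [S, A] for S = AX + XA, which
combines with -[S_{<0}, A] as in the linear case. -/
theorem tensor2_left {A A' X : Op} {a b : ℤ} (hA : OrdLE 1 a A) (hX : OrdLE 1 b X)
    (hQ : OrdLE 1 0 (comm X A)) : tensor2 (A, A') (X, 0) = (2⁻¹ : ℂ) •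
      (comm (partGE 0 (A ⋆ X + X ⋆ A)) A, comm (partGE 0 (A ⋆ X + X ⋆ A)) A') := by
  have hS : OrdLE 1 (a + b) (A ⋆ X + X ⋆ A) := (hA.mul hX).add ((hX.mul hA).mono (by omega))
  simp only [tensor2, commSum, anticommSum, comm_zero_left, opMul_zero, zero_opMul, add_zero]
  rw [hQ.partLT_eq_self (by norm_num), hQ.partGE_eq_zero (by norm_num), zero_opMul, opMul_zero,
    sub_zero, sub_zero, add_assoc, anticomm_comm hA hX]
  congr 2
  conv_lhs =>
    rhs
    rw [← partGE_add_partLT 0 (A ⋆ X + X ⋆ A), comm_add_left (hS.partGE 0) (hS.partLT 0) hA]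
  rw [comm_neg_left]
  abel

theorem tensor2_right {A A' X : Op} {a b : ℤ} (hA : OrdLE (-1) a A') (hX : OrdLE (-1) b X)
    (hQ : OrdLE (-1) (-1) (comm X A')) : tensor2 (A, A') (0, X) = (2⁻¹ : ℂ) •
      (comm (-partLT 0 (A' ⋆ X + X ⋆ A')) A, comm (-partLT 0 (A' ⋆ X + X ⋆ A')) A') := by
  have hS : OrdLE (-1) (a + b) (A' ⋆ X + X ⋆ A') :=
    (hA.mul hX).add ((hX.mul hA).mono (by omega))
  simp only [tensor2, commSum, anticommSum, comm_zero_left, opMul_zero, zero_opMul, zero_add]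
  rw [hQ.partLT_eq_zero (by norm_num), hQ.partGE_eq_self (by norm_num), zero_opMul, opMul_zero,
    add_zero, add_zero, sub_sub, anticomm_comm hA hX]
  congr 2
  conv_lhs =>
    rhs
    rw [← partGE_add_partLT 0 (A' ⋆ X + X ⋆ A'), comm_add_left (hS.partGE 0) (hS.partLT 0) hA]
  rw [comm_neg_left]
  abel

/-- The geometric series telescopes. Finite support of r makes the boundary term vanish and keeps
the `finsum` away from its default value. -/
theorem geomShift_sub {N : ℕ} (hN : 0 < N) {r : ℤ → ℂ} (hr : FinSupp r) :
    geomShift N (fun n => r (n + N) - r n) = -r := by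
  funext n
  have hinj : Function.Injective fun j : ℕ => n + (j : ℤ) * N := by
    intro j j' hj
    simpa [hN.ne'] using hj
  have hev : ∀ᶠ j : ℕ in atTop, r (n + j * N) = 0 := by
    rw [← Nat.cofinite_eq_atTop]
    exact hinj.tendsto_cofinite.eventually (finSupp_iff.1 hr)
  obtain ⟨J, hJ⟩ := eventually_atTop.1 hev
  rw [geomShift, finsum_eq_sum_of_support_subset (s := Finset.range J)]
  · have := Finset.sum_range_sub (fun j : ℕ => r (n + j * N)) J
    rw [hJ J le_rfl] at this
    simp only [Nat.cast_zero, zero_mul, add_zero, zero_sub] at this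
    rw [Pi.neg_apply, ← this]
    refine Finset.sum_congr rfl fun j _ => ?_
    congr 2
    push_cast; ring
  · intro j hj
    by_contra hj'
    simp only [Finset.coe_range, Set.mem_Iio, not_lt] at hj'
    apply hj
    have := hJ (j + 1) (by omega)
    push_cast at this
    simp only
    rw [hJ j hj', show n + (j : ℤ) * N + N = n + (j + 1) * N by ring, this, sub_zero]

/-! ### Lax pairs in the operator rings -/

theorem isVariation_iff {V : Op × Op} : IsVariation V ↔
    (OrdLE 1 0 V.1 ∧ Symb 0 V.1) ∧ OrdLE (-1) 1 V.2 ∧ Symb 0 V.2 := by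
  constructor
  · intro h
    exact ⟨⟨fun i hi => h.top i (by simpa using hi), fun i => finSupp_iff.1 (h.fin i)⟩,
      fun i hi => h.hat_bot i (by simp at hi; omega), fun i => finSupp_iff.1 (h.hat_fin i)⟩
  · rintro ⟨⟨h1, h2⟩, h3, h4⟩
    exact ⟨fun i hi => h1 i (by simpa using hi), h2.finSupp,
      fun i hi => h3 i (by simp; omega), h4.finSupp⟩

theorem exists_symb {A : Op} (h : ∀ i, AlmostConst (A i)) : ∃ a, Symb a A := by
  choose a ha using fun i => almostConst_iff.1 (h i)
  exact ⟨a, ha⟩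

theorem Symb.almostConst {a : ℤ → ℂ} {A : Op} (h : Symb a A) (i : ℤ) : AlmostConst (A i) :=
  almostConst_iff.2 ⟨a i, h i⟩

theorem IsLaxPair.exists_lax {p : Op × Op} (hp : IsLaxPair p) :
    ∃ L : DOp 1, L.op = p.1 ∧ DOp.IsLax 1 L := by
  have h : OrdLE 1 1 p.1 := fun i hi => hp.top i (by simpa using hi)
  refine ⟨DOp.mk p.1 h, rfl, h, fun i => ?_, fun n => ?_⟩
  · rcases lt_trichotomy i 1 with hi | rfl | hi
    · rw [Pi.single_eq_of_ne (by simpa using hi.ne)]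
      exact finSupp_iff.1 (hp.fin i (by omega))
    · simp [hp.lead]
    · rw [Pi.single_eq_of_ne (by simpa using hi.ne')]
      simp [hp.top i hi]
  · simp [hp.lead]

theorem IsLaxPair.exists_laxHat {p : Op × Op} (hp : IsLaxPair p) :
    ∃ c, ∃ L : DOp (-1), L.op = p.2 ∧ DOp.IsLax c L := by
  have h : OrdLE (-1) 1 p.2 := fun i hi => hp.hat_bot i (by simp at hi; omega)
  obtain ⟨c, hc⟩ := almostConst_iff.1 hp.hat_lead
  refine ⟨c, DOp.mk p.2 h, rfl, h, fun i => ?_, fun n => by simpa using hp.hat_ne n⟩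
  rcases lt_trichotomy i (-1) with hi | rfl | hi
  · rw [Pi.single_eq_of_ne (by simpa using hi.ne)]
    simp [hp.hat_bot i hi]
  · simpa using hc
  · rw [Pi.single_eq_of_ne (by simpa using hi.ne')]
    exact finSupp_iff.1 (hp.hat_fin i (by omega))

namespace DOp

variable {ε : ℤˣ} {c : ℂ} {L : DOp ε}

/-- Two operators of finite order with almost constant coefficients which have the same pairing
with the first variations of `L ^ N` agree. -/
theorem IsLax.eq_of_tr_powVar (hL : IsLax c L) {N : ℕ} (hN : 0 < N) {δ : ℤ} {X Y : Op}
    (hX : ∀ i, AlmostConst (X i)) (hY : ∀ i, AlmostConst (Y i)) {m m' : ℤ} (hXo : OrdLE ε m X)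
    (hYo : OrdLE ε m' Y) (hXb : ∀ i : ℤ, ε * i ≤ -N - δ → X i = 0)
    (hYb : ∀ i : ℤ, ε * i ≤ -N - δ → Y i = 0)
    (h : ∀ V : Op, OrdLE ε δ V → Symb 0 V →
      tr (X ⋆ powVar N L.op V) = tr (Y ⋆ powVar N L.op V)) : X = Y := by
  obtain ⟨a, ha⟩ := exists_symb hX
  obtain ⟨b, hb⟩ := exists_symb hY
  rw [← sub_eq_zero]
  refine hL.eq_zero_of_tr_mul_dpow hN (Z := DOp.mk X hXo - DOp.mk Y hYo) (δ := δ)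
    (ha.sub hb) (fun i hi => ?_) fun V hV hV0 => ?_
  · simp [hXb i hi, hYb i hi]
  · have hD := symb_zero_dpow hL hV0 N
    rw [sub_mul, op_sub, tr_sub, op_mul, op_mul, op_mk, op_mk, op_dpow, h V.op hV hV0, sub_self]
    · exact (symb_mul_zero (A := DOp.mk X hXo) ha hD).finSupp 0
    · exact (symb_mul_zero (A := DOp.mk Y hYo) hb hD).finSupp 0

/-- The derivation property at the level of raw operators: it transports a Lax equation for L to the
power L^N. -/
theorem powVar_comm {m : ℤ} {B : Op} (hB : OrdLE ε m B) (L : DOp ε) (N : ℕ) :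
    powVar N L.op (comm B L.op) = comm B (opPow L.op N) := by
  have := congrArg op (dpow_comm L (DOp.mk B hB) N)
  rw [op_dpow] at this
  rw [← op_pow]
  exact this

theorem comm_opPow (L : DOp ε) (k : ℕ) : comm (opPow L.op k) L.op = 0 := by
  have : L ^ k * L - L * L ^ k = 0 := sub_eq_zero.2 (Commute.pow_self L k).eq
  rw [← op_pow]
  exact congrArg op this

theorem symb_comm_op {a b : ℤ → ℂ} {m m' : ℤ} {A B : Op} (hA : Symb a A) (hB : Symb b B)
    (hA' : OrdLE ε m A) (hB' : OrdLE ε m' B) : Symb 0 (comm A B) :=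
  symb_comm (A := DOp.mk A hA') (B := DOp.mk B hB') hA hB

/-- The commutator with a truncation of `B` only involves the complementary part. -/
theorem comm_partGT_ordLE {N : ℕ} (hL : IsLax c L) {B : DOp ε} (hBL : Commute B L) (δ : ℤ) :
    OrdLE ε (-δ) (comm (partGT ε (-N - δ) B.op) (opPow L.op N)) := by
  have hR : OrdLE ε (-N - δ) (B.op - partGT ε (-N - δ) B.op) := partGT_ordLE
  obtain ⟨b, hb⟩ := B.exists_ordLE
  have hA := hL.ord.pow N
  have h0 : comm B.op (opPow L.op N) = 0 := by
    rw [← op_pow]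
    exact congrArg op (sub_eq_zero.2 (hBL.pow_right N).eq)
  have h1 := comm_add_left (hb.partGT (-N - δ)) hR hA
  rw [add_sub_cancel, h0] at h1
  -- Since B commutes with L^N, the commutator of the kept part is minus that of the discarded part,
  -- whose order is at most -N-δ.
  rw [eq_neg_of_add_eq_zero_left h1.symm]
  exact ((comm_ordLE hR hA).mono (by omega)).neg

end DOp

/-! ### Gradients: uniqueness and the Hamiltonians -/

open DOp

variable {p : Op × Op} {N M : ℕ}

theorem powVar_zero (N : ℕ) (A : Op) : powVar N A 0 = 0 := by
  simp [powVar, opMul_zero, zero_opMul]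

theorem HasGradient.unique (hp : IsLaxPair p) (hN : 0 < N) (hM : 0 < M) {F : Op × Op → ℂ}
    {X Y : Op × Op} (hX : HasGradient N M F p X) (hY : HasGradient N M F p Y) : X = Y := by
  obtain ⟨L, hLp, hL⟩ := hp.exists_lax
  obtain ⟨c, L', hLp', hL'⟩ := hp.exists_laxHat
  obtain ⟨hXc, hX⟩ := hX
  obtain ⟨hYc, hY⟩ := hY
  have key : ∀ V, IsVariation V → pairing X (powPairVar N M p V) = pairing Y (powPairVar N M p V) :=
    fun V hV => (hX V hV).unique (hY V hV)
  refine Prod.ext ?_ ?_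
  · obtain ⟨K, hK⟩ := hXc.top
    obtain ⟨K', hK'⟩ := hYc.top
    refine hL.eq_of_tr_powVar hN (δ := 0) hXc.coeff hYc.coeff (m := K) (m' := K')
      (fun i hi => hK i (by simpa using hi)) (fun i hi => hK' i (by simpa using hi))
      (fun i hi => hXc.bot i (by simpa using hi)) (fun i hi => hYc.bot i (by simpa using hi))
      fun V hV hV0 => ?_
    -- Varying one component at a time decouples the pairing; the bounds δ = 0 here and δ = 1 for L̂
    -- are the leading degrees of the two kinds of variation.
    have := key (V, 0) (isVariation_iff.2 ⟨⟨hV, hV0⟩, OrdLE.zero _ _, Symb.zero⟩)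
    simpa [pairing, powPairVar, powVar_zero, opMul_zero, tr_zero, hLp] using this
  · obtain ⟨K, hK⟩ := hXc.hat_bot
    obtain ⟨K', hK'⟩ := hYc.hat_bot
    refine hL'.eq_of_tr_powVar hM (δ := 1) hXc.hat_coeff hYc.hat_coeff (m := -K) (m' := -K')
      (fun i hi => hK i (by simp at hi; omega)) (fun i hi => hK' i (by simp at hi; omega))
      (fun i hi => hXc.hat_top i (by simp at hi; omega))
      (fun i hi => hYc.hat_top i (by simp at hi; omega)) fun V hV hV0 => ?_
    have := key (0, V) (isVariation_iff.2 ⟨⟨OrdLE.zero _ _, Symb.zero⟩, hV, hV0⟩)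
    simpa [pairing, powPairVar, powVar_zero, opMul_zero, tr_zero, hLp'] using this

theorem HasGradient.grad_eq (hp : IsLaxPair p) (hN : 0 < N) (hM : 0 < M) {F : Op × Op → ℂ}
    {X : Op × Op} (hX : HasGradient N M F p X) : grad N M F p = X := by
  have h : HasSomeGradient N M F p := ⟨X, hX⟩
  rw [grad, dif_pos h]
  exact h.choose_spec.unique hp hN hM hX

theorem HasSomeGradient.hasGradient {F : Op × Op → ℂ} (h : HasSomeGradient N M F p) :
    HasGradient N M F p (grad N M F p) := by
  rw [grad, dif_pos h]
  exact h.choose_spec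

theorem hasGradient_ham {L : DOp 1} (hLp : L.op = p.1) {c : ℂ} (hL : IsLax c L)
    (hN : 0 < N) {k : ℕ} (hk : 0 < k) {b : ℤ → ℂ} {B : DOp 1} (hB : Symb b B.op)
    (hBL : Commute B L) (hBN : B * L ^ N = L ^ k) :
    HasGradient N M (ham N k) p (partGT 1 (-N - 0) B.op, 0) := by
  have hs := hB.partGT 1 (-N - 0)
  obtain ⟨m, hm⟩ := B.exists_ordLE
  refine ⟨⟨hs.almostConst, fun i hi => ?_, ⟨m, fun i hi => ?_⟩, Symb.zero.almostConst,
    fun _ _ => rfl, ⟨0, fun _ _ => rfl⟩⟩, fun V hV => ?_⟩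
  · have : ¬ -(N : ℤ) < i := by omega
    simp [partGT, this]
  · exact hm.partGT _ i (by simpa using hi)
  · obtain ⟨⟨h1, h2⟩, -⟩ := isVariation_iff.1 hV
    have := hL.hasDerivAt_hamiltonian (V := DOp.mk V.1 h1) hN hk hB hBL hBN h2 h1
    rw [hLp] at this
    refine this.congr_deriv ?_
    simp only [pairing, zero_opMul, tr_zero, add_zero]
    rfl

theorem hasGradient_hamHat {L : DOp (-1)} (hLp : L.op = p.2) {c : ℂ} (hL : IsLax c L)
    (hM : 0 < M) {k : ℕ} (hk : 0 < k) {b : ℤ → ℂ} {B : DOp (-1)} (hB : Symb b B.op)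
    (hBL : Commute B L) (hBM : B * L ^ M = L ^ k) :
    HasGradient N M (hamHat M k) p (0, partGT (-1) (-M - 1) B.op) := by
  have hs := hB.partGT (-1) (-M - 1)
  obtain ⟨m, hm⟩ := B.exists_ordLE
  refine ⟨⟨Symb.zero.almostConst, fun _ _ => rfl, ⟨0, fun _ _ => rfl⟩, hs.almostConst,
    fun i hi => ?_, ⟨-m, fun i hi => ?_⟩⟩, fun V hV => ?_⟩
  · have : ¬ -(M : ℤ) - 1 < -i := by omega
    simp [partGT, this]
  · exact hm.partGT _ i (by simp; omega)
  · obtain ⟨-, h1, h2⟩ := isVariation_iff.1 hV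
    have := hL.hasDerivAt_hamiltonian (V := DOp.mk V.2 h1) hM hk hB hBL hBM h2 h1
    rw [hLp] at this
    refine this.congr_deriv ?_
    simp only [pairing, zero_opMul, tr_zero, zero_add]
    rfl

/-! ### The Toda flows as variations -/

/-- Since L^k commutes with L, [(L^k)_{≥0}, L] = -[(L^k)_{<0}, L], which has order at most 0; finite
support comes from the vanishing symbol of a commutator. -/
theorem isVariation_flow (hp : IsLaxPair p) (k : ℕ) : IsVariation (flow k p) := by
  obtain ⟨L, hLp, hL⟩ := hp.exists_lax
  obtain ⟨c, L', hLp', hL'⟩ := hp.exists_laxHat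
  have hk := hL.ord.pow k
  have hs := symb_pow hL.symb k
  rw [op_pow] at hs
  rw [isVariation_iff, flow, ← hLp, ← hLp']
  refine ⟨⟨?_, symb_comm_op (hs.partGE 0) hL.symb (hk.partGE 0) hL.ord⟩, ?_,
    symb_comm_op (hs.partGE 0) hL'.symb (partGE_ordLE 0 _) hL'.ord⟩
  · have h := comm_add_left (hk.partGE 0) (hk.partLT 0) hL.ord
    rw [partGE_add_partLT, comm_opPow] at h
    rw [eq_neg_of_add_eq_zero_left h.symm]
    exact (comm_ordLE (partLT_ordLE 0 _) hL.ord).neg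
  · exact comm_ordLE (partGE_ordLE 0 _) hL'.ord

theorem isVariation_flowHat (hp : IsLaxPair p) (k : ℕ) : IsVariation (flowHat k p) := by
  obtain ⟨L, hLp, hL⟩ := hp.exists_lax
  obtain ⟨c, L', hLp', hL'⟩ := hp.exists_laxHat
  have hk := hL'.ord.pow k
  have hs := symb_pow hL'.symb k
  rw [op_pow] at hs
  rw [isVariation_iff, flowHat, ← hLp, ← hLp']
  refine ⟨⟨?_, symb_comm_op (hs.partLT 0).neg hL.symb (partLT_ordLE 0 _).neg hL.ord⟩, ?_,
    symb_comm_op (hs.partLT 0).neg hL'.symb (hk.partLT 0).neg hL'.ord⟩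
  · exact comm_ordLE (partLT_ordLE 0 _).neg hL.ord
  · have h := comm_add_left (hk.partGE 0) (hk.partLT 0) hL'.ord
    rw [partGE_add_partLT, comm_opPow] at h
    dsimp only
    rw [comm_neg_left, neg_eq_of_add_eq_zero_left h.symm]
    exact comm_ordLE (partGE_ordLE 0 _) hL'.ord

theorem powPairVar_flow (hp : IsLaxPair p) (k : ℕ) : powPairVar N M p (flow k p)
    = (comm (partGE 0 (opPow p.1 k)) (opPow p.1 N),
      comm (partGE 0 (opPow p.1 k)) (opPow p.2 M)) := by
  obtain ⟨L, hLp, hL⟩ := hp.exists_lax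
  obtain ⟨c, L', hLp', hL'⟩ := hp.exists_laxHat
  rw [powPairVar, flow, ← hLp, ← hLp', powVar_comm ((hL.ord.pow k).partGE 0),
    powVar_comm (partGE_ordLE 0 _)]

theorem powPairVar_flowHat (hp : IsLaxPair p) (k : ℕ) : powPairVar N M p (flowHat k p)
    = (comm (-partLT 0 (opPow p.2 k)) (opPow p.1 N),
      comm (-partLT 0 (opPow p.2 k)) (opPow p.2 M)) := by
  obtain ⟨L, hLp, hL⟩ := hp.exists_lax
  obtain ⟨c, L', hLp', hL'⟩ := hp.exists_laxHat
  rw [powPairVar, flowHat, ← hLp, ← hLp', powVar_comm (partLT_ordLE 0 _).neg,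
    powVar_comm ((hL'.ord.pow k).partLT 0).neg]

/-! ### The tensors at the gradients of the Hamiltonians -/

theorem tensor1_ham (hp : IsLaxPair p) {L : DOp 1} (hLp : L.op = p.1) {c : ℂ} (hL : IsLax c L)
    (hN : 0 < N) (k : ℕ) : tensor1 (powPair N M p) (partGT 1 (-N - 0) (L ^ k).op, 0)
      = powPairVar N M p (flow k p) := by
  rw [powPairVar_flow hp, powPair, ← hLp,
    tensor1_left (hL.ord.pow N) ((ordLE_pow hL.ord k).partGT _)
      (comm_partGT_ordLE hL (Commute.pow_self L k) 0)]
  have : partGE 0 (partGT 1 (-N - 0) (L ^ k).op) = partGE 0 (opPow L.op k) := by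
    funext i
    by_cases hi : 0 ≤ i
    · have : -(N : ℤ) < i := by omega
      simp [partGE, partGT, hi, this]
    · simp [partGE, hi]
  rw [this]

theorem tensor1_hamHat (hp : IsLaxPair p) {L : DOp (-1)} (hLp : L.op = p.2) {c : ℂ}
    (hL : IsLax c L) (k : ℕ) :
    tensor1 (powPair N M p) (0, partGT (-1) (-M - 1) (L ^ k).op)
      = powPairVar N M p (flowHat k p) := by
  rw [powPairVar_flowHat hp, powPair, ← hLp,
    tensor1_right (hL.ord.pow M) ((ordLE_pow hL.ord k).partGT _)
      (comm_partGT_ordLE hL (Commute.pow_self L k) 1)]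
  have : partLT 0 (partGT (-1) (-M - 1) (L ^ k).op) = partLT 0 (opPow L.op k) := by
    funext i
    by_cases hi : i < 0
    · have : -(M : ℤ) - 1 < -i := by omega
      simp [partLT, partGT, hi, this]
    · simp [partLT, hi]
  rw [this]

/-- The anticommutator of `L ^ N` with a truncation of `B = L ^ (k - N)`. -/
theorem anticomm_partGT {ε : ℤˣ} {L B : DOp ε} (hBL : Commute B L) {k : ℕ}
    (hBN : B * L ^ N = L ^ k) (m : ℤ) :
    opPow L.op N ⋆ partGT ε m B.op + partGT ε m B.op ⋆ opPow L.op N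
      = (2 : ℂ) • opPow L.op k - (opPow L.op N ⋆ (B.op - partGT ε m B.op)
        + (B.op - partGT ε m B.op) ⋆ opPow L.op N) := by
  obtain ⟨b, hb⟩ := B.exists_ordLE
  have h : ∀ X : DOp ε, L ^ N * X + X * L ^ N
      = (2 : ℂ) • L ^ k - (L ^ N * (B - X) + (B - X) * L ^ N) := fun X => by
    rw [mul_sub, sub_mul, ← (hBL.pow_right N).eq, hBN, two_smul]
    abel
  have := congrArg op (h (DOp.mk _ (hb.partGT m)))
  simpa using this

/-- Here Q contains only Λ^i with i ≥ 1, so its residue and the correction f vanish. The discarded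
part starts at Λ^(M+1) and L̂^M at Λ^(-M), so their anticommutator does not touch negative orders.
-/
theorem tensor2Red_hamHat (hp : IsLaxPair p) {L : DOp (-1)} (hLp : L.op = p.2) {c : ℂ}
    (hL : IsLax c L) {k : ℕ} {B : DOp (-1)} (hBL : Commute B L) (hBM : B * L ^ M = L ^ k) :
    tensor2Red N (powPair N M p) (0, partGT (-1) (-M - 1) B.op)
      = powPairVar N M p (flowHat k p) := by
  obtain ⟨b, hb⟩ := B.exists_ordLE
  have hQ := comm_partGT_ordLE (N := M) hL hBL 1
  have hR : OrdLE (-1) (-M - 1) (B.op - partGT (-1) (-M - 1) B.op) := partGT_ordLE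
  have hA := hL.ord.pow M
  have hcorr : corr N (powPair N M p) (0, partGT (-1) (-M - 1) B.op) = 0 := by
    have : res (commSum (powPair N M p) (0, partGT (-1) (-M - 1) B.op)) = 0 := by
      simp only [commSum, powPair, comm_zero_left, zero_add, res, ← hLp]
      exact hQ 0 (by simp)
    funext n
    simp [corr, this, geomShift]
  have hmul : mulOp 0 = 0 := by
    funext i; simp [mulOp]
  have hS : partLT 0 (opPow L.op M ⋆ partGT (-1) (-M - 1) B.op
      + partGT (-1) (-M - 1) B.op ⋆ opPow L.op M) = (2 : ℂ) • partLT 0 (opPow L.op k) := by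
    rw [anticomm_partGT hBL hBM]
    have h0 : OrdLE (-1) (-1) (opPow L.op M ⋆ (B.op - partGT (-1) (-M - 1) B.op)
        + (B.op - partGT (-1) (-M - 1) B.op) ⋆ opPow L.op M) :=
      ((hA.mul hR).mono (by omega)).add ((hR.mul hA).mono (by omega))
    funext i
    by_cases hi : i < 0
    · simp only [partLT, hi, if_true, Pi.sub_apply, Pi.smul_apply]
      rw [h0 i (by simp; omega), sub_zero]
    · simp [partLT, hi]
  rw [tensor2Red, hcorr, hmul, comm_zero_left, comm_zero_left, powPairVar_flowHat hp, powPair,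
    ← hLp, tensor2_right hA (hb.partGT _) hQ, hS, ← smul_neg, comm_smul_left, comm_smul_left]
  ext <;> simp

theorem opPow_top {L : DOp 1} (h : OrdLE 1 1 L.op) (h1 : L.op 1 = 1) (k : ℕ) :
    opPow L.op k k = 1 := by
  induction k with
  | zero => simp [opPow, mulOp]
  | succ k ih =>
    funext n
    have := opMul_top (h.pow k) h n
    simp only [Units.val_one, one_mul, mul_one, ih, h1] at this
    rw [opPow, Nat.cast_succ, this]
    simp

/-- The cancellation that dictates f: the halved anticommutator has nonnegative part (L^k)_{≥0} + f,
and the reduction subtracts the commutators with f. The leading coefficient 1 of L^N makes both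
residues explicit in r. -/
theorem tensor2Red_ham (hp : IsLaxPair p) {L : DOp 1} (hLp : L.op = p.1) {c : ℂ}
    (hL : IsLax c L) (hN : 0 < N) {k : ℕ} (hk : 0 < k) {B : DOp 1} (hBL : Commute B L)
    (hBN : B * L ^ N = L ^ k) {d : ℂ} (hB : Symb (Pi.single ((1 : ℤˣ) * (k - N) : ℤ) d) B.op) :
    tensor2Red N (powPair N M p) (partGT 1 (-N - 0) B.op, 0)
      = powPairVar N M p (flow k p) := by
  obtain ⟨b, hb⟩ := B.exists_ordLE
  obtain ⟨c', L', hLp', hL'⟩ := hp.exists_laxHat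
  have hQ := comm_partGT_ordLE (N := N) hL hBL 0
  set X := partGT 1 (-N - 0) B.op with hX
  have hR : OrdLE 1 (-N) (B.op - X) := by
    have : OrdLE 1 (-N - 0) (B.op - X) := partGT_ordLE
    exact this.mono (by omega)
  set R := B.op - X with hRdef
  have hA := hL.ord.pow N
  rw [mul_one] at hA
  have hlead : opPow L.op N N = 1 := opPow_top hL.ord (by rw [hLp]; exact hp.lead) N
  set r : ℤ → ℂ := R (-N) with hr
  have hXN : X (-N) = 0 := by simp [hX, partGT]
  -- B has its only nonzero symbol at order k - N, which differs from -N because k > 0.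
  have hrfin : FinSupp r := by
    rw [finSupp_iff]
    have := hB (-N)
    rw [Pi.single_eq_of_ne (by simp; omega)] at this
    simpa [hr, hRdef, hXN] using this
  have hAR : ∀ n, (opPow L.op N ⋆ R) 0 n = r (n + N) := fun n => by
    have := opMul_top hA hR n
    simp only [Units.val_one, one_mul, add_neg_cancel] at this
    rw [this, hlead]; simp [hr]
  have hRA : ∀ n, (R ⋆ opPow L.op N) 0 n = r n := fun n => by
    have := opMul_top hR hA n
    simp only [Units.val_one, one_mul, neg_add_cancel] at this
    rw [this, hlead]; simp [hr]
  have hres : res (commSum (powPair N M p) (X, 0)) = fun n => r (n + N) - r n := by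
    have h0 : comm B.op (opPow L.op N) = 0 := by
      rw [← op_pow]
      exact congrArg op (sub_eq_zero.2 (hBL.pow_right N).eq)
    -- Splitting [B, L^N] = 0 gives Q = -[R, L^N], whose residue only involves the top coefficient r
    -- of R.
    have h1 := comm_add_left (hb.partGT (-N - 0)) hR hA
    rw [hRdef, add_sub_cancel, h0] at h1
    funext n
    simp only [commSum, powPair, comm_zero_left, add_zero, res, ← hLp]
    rw [eq_neg_of_add_eq_zero_left h1.symm]
    change -((R ⋆ opPow L.op N) 0 n - (opPow L.op N ⋆ R) 0 n) = _
    rw [hAR, hRA, neg_sub]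
  have hcorr : ∀ n, corr N (powPair N M p) (X, 0) n = -2⁻¹ * (r n + r (n + N)) := by
    intro n
    rw [corr, hres, geomShift_sub hN hrfin]
    simp only [Pi.neg_apply]
    ring
  set f := corr N (powPair N M p) (X, 0) with hf
  have hS : partGE 0 (opPow L.op N ⋆ X + X ⋆ opPow L.op N)
      = (2 : ℂ) • (partGE 0 (opPow L.op k) + mulOp f) := by
    rw [hX, anticomm_partGT hBL hBN]
    have h0 : OrdLE 1 0 (opPow L.op N ⋆ R + R ⋆ opPow L.op N) :=
      ((hA.mul hR).mono (by omega)).add ((hR.mul hA).mono (by omega))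
    funext i n
    change partGE 0 ((2 : ℂ) • opPow L.op k - (opPow L.op N ⋆ R + R ⋆ opPow L.op N)) i n = _
    rcases lt_trichotomy i 0 with hi | rfl | hi
    · simp [partGE, mulOp, not_le.2 hi, hi.ne]
    · simp only [partGE, mulOp, le_refl, if_true, Pi.sub_apply, Pi.add_apply, Pi.smul_apply, hAR,
        hRA, hcorr, smul_eq_mul]
      ring
    · simp only [partGE, hi.le, if_true]
      rw [Pi.sub_apply, h0 i (by simpa using hi)]
      simp [partGE, mulOp, hi.le, hi.ne']
  have hP := (hL.ord.pow k).partGE 0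
  have hA' := hL'.ord.pow M
  rw [tensor2Red, powPairVar_flow hp, powPair, ← hLp, tensor2_left hA (hb.partGT _) hQ, hS,
    comm_smul_left, comm_smul_left, comm_add_left hP (OrdLE.mulOp 1 f) hA, ← hLp',
    -- In the second slot the products are taken among operators bounded below; multiplication by f
    -- is bounded on both sides and fits either ring.
    comm_add_left (partGE_ordLE 0 _) (OrdLE.mulOp (-1) f) hA']
  have hf' : corr N (opPow L.op N, opPow L'.op M) (X, 0) = f := by
    rw [hf, powPair, hLp, hLp']
  rw [hf']
  ext <;> simp

end Toda

end

/-! ### The bi-Hamiltonian representation -/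

theorem mainTheorem2 (N M : ℕ) (hN : 0 < N) (hM : 0 < M)
    (p : Toda.Op × Toda.Op) (hp : Toda.IsLaxPair p) :
    (∀ (F : Toda.Op × Toda.Op → ℂ) (X Y : Toda.Op × Toda.Op),
      Toda.HasGradient N M F p X → Toda.HasGradient N M F p Y → X = Y) ∧
    ∀ k : ℕ, 0 < k →
      Toda.HasSomeGradient N M (Toda.ham N k) p ∧
      Toda.HasSomeGradient N M (Toda.hamHat M k) p ∧
      Toda.IsVariation (Toda.flow k p) ∧
      Toda.IsVariation (Toda.flowHat k p) ∧
      ∀ F : Toda.Op × Toda.Op → ℂ, Toda.HasSomeGradient N M F p →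
        HasDerivAt (fun s : ℂ => F (p + s • Toda.flow k p))
          (Toda.bracket1 N M F (Toda.ham N (k + N)) p) 0 ∧
        HasDerivAt (fun s : ℂ => F (p + s • Toda.flow k p))
          (Toda.bracket2 N M F (Toda.ham N k) p) 0 ∧
        HasDerivAt (fun s : ℂ => F (p + s • Toda.flowHat k p))
          (Toda.bracket1 N M F (Toda.hamHat M (k + M)) p) 0 ∧
        HasDerivAt (fun s : ℂ => F (p + s • Toda.flowHat k p))
          (Toda.bracket2 N M F (Toda.hamHat M k) p) 0 := by
  refine ⟨fun F X Y hX hY => hX.unique hp hN hM hY, fun k hk => ?_⟩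
  obtain ⟨L, hLp, hL⟩ := hp.exists_lax
  obtain ⟨c, L', hLp', hL'⟩ := hp.exists_laxHat
  obtain ⟨B, hBL, hBN, -, d, hB⟩ := hL.exists_pow_sub k N
  obtain ⟨B', hBL', hBM, -, d', hB'⟩ := hL'.exists_pow_sub k M
  have g := Toda.hasGradient_ham (M := M) hLp hL hN hk hB hBL hBN
  have g' := Toda.hasGradient_hamHat (N := N) hLp' hL' hM hk hB' hBL' hBM
  -- For the index k + N the operator B is L^k itself, so no inverse of L is needed.
  have g₁ := Toda.hasGradient_ham (M := M) hLp hL hN (Nat.add_pos_left hk N)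
    (Toda.DOp.symb_pow hL.symb k) (Commute.pow_self L k) (pow_add L k N).symm
  have g₁' := Toda.hasGradient_hamHat (N := N) hLp' hL' hM (Nat.add_pos_left hk M)
    (Toda.DOp.symb_pow hL'.symb k) (Commute.pow_self L' k) (pow_add L' k M).symm
  have hv := Toda.isVariation_flow hp k
  have hv' := Toda.isVariation_flowHat hp k
  refine ⟨⟨_, g⟩, ⟨_, g'⟩, hv, hv', fun F hF => ?_⟩
  -- The gradient of F is tested on the flow itself; the brackets become the same pairing once each
  -- tensor is identified with the variation of 𝐀 along the flow.
  have hd := hF.hasGradient.2 _ hv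
  have hd' := hF.hasGradient.2 _ hv'
  refine ⟨?_, ?_, ?_, ?_⟩
  · rwa [Toda.bracket1, g₁.grad_eq hp hN hM, Toda.tensor1_ham hp hLp hL hN]
  · rwa [Toda.bracket2, g.grad_eq hp hN hM, Toda.tensor2Red_ham hp hLp hL hN hk hBL hBN hB]
  · rwa [Toda.bracket1, g₁'.grad_eq hp hN hM, Toda.tensor1_hamHat hp hLp' hL']
  · rwa [Toda.bracket2, g'.grad_eq hp hN hM, Toda.tensor2Red_hamHat hp hLp' hL' hBL' hBM]
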